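/- Let $d\ge 3$. For half-spaces $\langle a_j,x\rangle\le b_j$ in $\mathbb R^d$ ($1\le j\le n$) with bounding hyperplanes $\pi_j$, let $P$ be their intersection and $F_j=P\cap\pi_j$. Let $P(t)$, $0\le t\le 1$, be a family of $d$-dimensional bounded polytopes with exactly $n$ facets $F_1(t),\dots,F_n(t)$, presented in this way, where for one index $i$ the hyperplane $\pi_i(t)$ (with its half-space) moves continuously in $t$ and all other half-spaces are fixed. An edge $e$ of $P(0)$ is called *vanishing* if the facets $F_j(1)$ of $P(1)$, over all $j$ with $e\subseteq F_j(0)$, have no common point. The family is a *fundamental deformation* if 1. there is $t_0\in(0,1)$ such that $P(t)$ is simple exactly for $t\ne t_0$; 2. there is exactly one vertex of $P(0)$ that is an intersection of hyperplanes $\pi_j$, $j\neq i$, and lies on $\pi_i(t)$ for some $t\in[0,1]$; this vertex lies on $\pi_i(t_0)$ and is not in $P(t)$ for $t>t_0$; 3. $P(t)\subseteq P(s)$ for $t>s$; 4. exactly one edge of $P(0)$ is vanishing. An *edge-following path* of length $l\in\mathbb N$ in a polytope $P$ is a continuous map $p:[0,l]\to P$ such that $p(s)$ is a vertex if and only if $s$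 is an integer, and such that $p([m,m+1])$ is an edge of $P$ for each integer $0\le m<l$. Let $P(t)$ be a fundamental deformation with vanishing edge $vw$. Let $N$ be the face of $P(1)$ cut out by the facets $F_j(1)$ for those $j$ for which exactly one of $v,w$ lies on $F_j(0)$. Call a vertex $x'$ of $P(1)$ a *counterpart* of a vertex $x$ of $P(0)$ if either $x\notin\{v,w\}$ and $x\in F_j(0)\Leftrightarrow x'\in F_j(1)$ for all $j$, or $x\in\{v,w\}$ and $x'\in N$. Then: * There is $k\ne i$ such that the indices $j$ for which exactly one of $v,w$ lies on $F_j(0)$ are exactly $i$ and $k$; thus $N=F_i(1)\cap F_k(1)$. The face $N$ is a $(d-2)$-simplex, and any two distinct vertices of $P(1)$ in $N$ are joined by an edge of $P(1)$. * Every vertex of $P(0)$ has a counterpart. * Let $p$ be an edge-following path of length $l$ in $P(0)$ between two distinct vertices $x=p(0)$ and $y=p(l)$ which does not pass through exactly one of $v$ and $w$. Then for every counterpart $x'$ of $x$ and every counterpart $y'$ of $y$ there is an edge-following path $p'$ in $P(1)$ from $x'$ to $y'$ of length $l'\le l$, all of whose vertices are counterparts of vertices on $p$. If $p$ passes through neither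 $v$ nor $w$, one can take $l'=l$ with $p'(m)$ a counterpart of $p(m)$ for every integer $0\le m\le l$. -/

import Mathlib

/-- A system of `n` half-spaces `⟪a_j, x⟫ ≤ b_j` in `d`-dimensional Euclidean space. -/
structure HalfspaceSystem (d n : ℕ) where
  normal : Fin n → EuclideanSpace ℝ (Fin d)
  offset : Fin n → ℝ

namespace HalfspaceSystem

variable {d n : ℕ}

/-- The bounding hyperplane `π_j`. -/
def hyperplane (H : HalfspaceSystem d n) (j : Fin n) : Set (EuclideanSpace ℝ (Fin d)) :=
  {x | inner ℝ (H.normal j) x = H.offset j}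

/-- The intersection of all the half-spaces. -/
def polytope (H : HalfspaceSystem d n) : Set (EuclideanSpace ℝ (Fin d)) :=
  {x | ∀ j, inner ℝ (H.normal j) x ≤ H.offset j}

/-- The part `F_j` of the polytope that lies on `π_j`. -/
def facet (H : HalfspaceSystem d n) (j : Fin n) : Set (EuclideanSpace ℝ (Fin d)) :=
  H.polytope ∩ H.hyperplane j

/-- The half-spaces present a `d`-dimensional (bounded) polytope with exactly `n` facets, namely the
pairwise distinct sets `F_j`. -/
structure PresentsPolytope (H : HalfspaceSystem d n) : Prop where
  normal_ne_zero : ∀ j, H.normal j ≠ 0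
  isBounded : Bornology.IsBounded H.polytope
  interior_nonempty : (interior H.polytope).Nonempty
  facet_dim : ∀ j, Module.finrank ℝ (vectorSpan ℝ (H.facet j)) + 1 = d
  facet_injective : Function.Injective H.facet

/-- Every vertex lies on exactly `d` facets. -/
def IsSimple (H : HalfspaceSystem d n) : Prop :=
  ∀ x ∈ H.polytope.extremePoints ℝ, {j | x ∈ H.facet j}.ncard = d

end HalfspaceSystem

/-- `e` is an edge of the polytope `P`: a face of `P` that is a nondegenerate segment joining two
vertices of `P`. -/
def IsPolytopeEdge {d : ℕ} (P e : Set (EuclideanSpace ℝ (Fin d))) : Prop :=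
  IsExposed ℝ P e ∧
    ∃ x ∈ P.extremePoints ℝ, ∃ y ∈ P.extremePoints ℝ, x ≠ y ∧ e = segment ℝ x y

/-- `p : [0, l] → P` is an edge-following path of length `l`: it is continuous, `p s` is a vertex
exactly when `s` is an integer, and each `p([m, m + 1])` is an edge of `P`. (Values of `p` outside
`[0, l]` are irrelevant.) -/
structure IsEdgeFollowingPath {d : ℕ} (P : Set (EuclideanSpace ℝ (Fin d))) (l : ℕ)
    (p : ℝ → EuclideanSpace ℝ (Fin d)) : Prop where
  continuousOn : ContinuousOn p (Set.Icc 0 (l : ℝ))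
  vertex_iff : ∀ s ∈ Set.Icc 0 (l : ℝ), p s ∈ P.extremePoints ℝ ↔ ∃ m : ℕ, s = m
  edge : ∀ m : ℕ, m < l → IsPolytopeEdge P (p '' Set.Icc (m : ℝ) (m + 1))

/-- The path `p : [0, l] → P` passes through `v`. -/
def PassesThrough {d : ℕ} (l : ℕ) (p : ℝ → EuclideanSpace ℝ (Fin d))
    (v : EuclideanSpace ℝ (Fin d)) : Prop :=
  v ∈ p '' Set.Icc 0 (l : ℝ)

/-- For a family `P(t)`, `0 ≤ t ≤ 1`: an edge `e` of `P(0)` is vanishing if the face of `P(1)` cut out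
by the facets that contained `e` is empty. -/
def IsVanishingEdge {d n : ℕ} (S : ℝ → HalfspaceSystem d n)
    (e : Set (EuclideanSpace ℝ (Fin d))) : Prop :=
  IsPolytopeEdge (S 0).polytope e ∧
    {z ∈ (S 1).polytope | ∀ j, e ⊆ (S 0).facet j → z ∈ (S 1).facet j} = ∅

/-- `u` is a vertex of `P(0)` that is an intersection of some of the hyperplanes `π_j`, `j ≠ i`, and
is passed through by the moving hyperplane `π_i(t)`. -/
def IsPassedVertex {d n : ℕ} (S : ℝ → HalfspaceSystem d n) (i : Fin n)
    (u : EuclideanSpace ℝ (Fin d)) : Prop :=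
  u ∈ (S 0).polytope.extremePoints ℝ ∧
    (∃ J : Finset (Fin n), i ∉ J ∧ (⋂ j ∈ J, (S 0).hyperplane j) = {u}) ∧
    ∃ t ∈ Set.Icc (0 : ℝ) 1, u ∈ (S t).hyperplane i

/-- The family `P(t) = (S t).polytope`, `0 ≤ t ≤ 1`, is a fundamental deformation, moving the
hyperplane `π_i`. -/
structure IsFundamentalDeformation {d n : ℕ} (S : ℝ → HalfspaceSystem d n) (i : Fin n) : Prop where
  presents : ∀ t ∈ Set.Icc (0 : ℝ) 1, (S t).PresentsPolytope
  normal_fixed : ∀ t ∈ Set.Icc (0 : ℝ) 1, ∀ j, j ≠ i → (S t).normal j = (S 0).normal j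
  offset_fixed : ∀ t ∈ Set.Icc (0 : ℝ) 1, ∀ j, j ≠ i → (S t).offset j = (S 0).offset j
  continuous_normal : ContinuousOn (fun t => (S t).normal i) (Set.Icc 0 1)
  continuous_offset : ContinuousOn (fun t => (S t).offset i) (Set.Icc 0 1)
  passes : ∃ t₀ ∈ Set.Ioo (0 : ℝ) 1,
    (∀ t ∈ Set.Icc (0 : ℝ) 1, (S t).IsSimple ↔ t ≠ t₀) ∧
    ∃ v, (∀ u, IsPassedVertex S i u ↔ u = v) ∧
      v ∈ (S t₀).hyperplane i ∧ ∀ t ∈ Set.Ioc t₀ 1, v ∉ (S t).polytope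
  decreasing : ∀ s ∈ Set.Icc (0 : ℝ) 1, ∀ t ∈ Set.Icc (0 : ℝ) 1, s < t →
    (S t).polytope ⊆ (S s).polytope
  existsUnique_vanishing : ∃! e : Set (EuclideanSpace ℝ (Fin d)), IsVanishingEdge S e

/-- The face of `P(1)` cut out by the facets that contained exactly one of the two ends `v, w` of the
vanishing edge. -/
def newFace {d n : ℕ} (S : ℝ → HalfspaceSystem d n) (v w : EuclideanSpace ℝ (Fin d)) :
    Set (EuclideanSpace ℝ (Fin d)) :=
  {z ∈ (S 1).polytope |
    ∀ j, Xor (v ∈ (S 0).facet j) (w ∈ (S 0).facet j) → z ∈ (S 1).facet j}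

/-- The vertex `x'` of `P(1)` is a counterpart of the vertex `x` of `P(0)`: if `x` is not an end of the
vanishing edge, then `x'` lies on the same facets as `x`; the counterparts of `v` and of `w` are all
the vertices of the new face. -/
def IsCounterpart {d n : ℕ} (S : ℝ → HalfspaceSystem d n) (v w x x' : EuclideanSpace ℝ (Fin d)) :
    Prop :=
  x ∈ (S 0).polytope.extremePoints ℝ ∧ x' ∈ (S 1).polytope.extremePoints ℝ ∧
    ((x ≠ v ∧ x ≠ w ∧ ∀ j, x ∈ (S 0).facet j ↔ x' ∈ (S 1).facet j) ∨
      ((x = v ∨ x = w) ∧ x' ∈ newFace S v w))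

/-! A vertex is recorded by the set of indices of the bounding hyperplanes through it. While `P(t)`
is simple, these sets cannot change: such a vertex is cut out transversally by `d` hyperplanes, so
it survives a small motion of `π_i`, and limits of such vertices stay on the same facets because
every `P(t)` lies in the compact `P(0)` (`isVertexIndex_of_isPreconnected`). So everything happens
at `t₀`, where the passed vertex `u` is the only vertex on more than `d` facets
(`card_tight_of_ne`): it lies on the set `D` of its `d` facets in `P(0)`, and on `π_i`. Index sets
not contained in `D ∪ {i}` are the same before and after (`isVertexIndex_zero_iff_one`).

The remaining candidates are `D`, which is lost, and for `j ∈ D` the set `neighbor S i u j`, which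
is `D` with `j` replaced by `i`. The latter belongs to the point where `π_i(t)` meets the line
through `u` along which only the facet `j` is left. The slack of `u` at `π_i(t)` changes sign at
`t₀`, so this point is on the correct half of the line on exactly one side of `t₀`
(`isVertexIndex_neighbor_zero_iff`). A neighbor present in `P(0)` spans a vanishing edge with `u`,
and every vanishing edge has a neighbor as an end; uniqueness of the vanishing edge leaves exactly
one index `j = k` (`exists_isFlip`). The deformation is thus a flip: the vertices `D` and `D - k +
i` give way to the `d - 1` vertices `D - j + i` with `j ≠ k`, which share `i` and `k` and span a
simplex.

Adjacency in a simple polytope means sharing `d - 1` facets. Hence edges off the vanishing edge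
carry over, and an edge into one of its ends becomes an edge into a suitable new vertex
(`exists_adjacent_newVertex`). For a path through both `v` and `w`, the parts before the first and
after the last visit to `{v, w}` are kept and joined by at most one edge of the new face; the part
cut out had at least one edge. -/

open Filter Topology HalfspaceSystem

/-! ### Faces, vertices and edges in terms of active constraints. -/

namespace HalfspaceSystem

variable {d n : ℕ}

open Classical in
/-- The indices of the bounding hyperplanes through `x`. -/
noncomputable def tight (H : HalfspaceSystem d n) (x : EuclideanSpace ℝ (Fin d)) : Finset (Fin n) :=
  Finset.univ.filter fun j => inner ℝ (H.normal j) x = H.offset j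

/-- The normals with indices in `I` span the space. -/
def Spans (H : HalfspaceSystem d n) (I : Finset (Fin n)) : Prop :=
  ∀ r : EuclideanSpace ℝ (Fin d), (∀ j ∈ I, inner ℝ (H.normal j) r = 0) → r = 0

/-- `I` is the set of facets through some vertex of the polytope. -/
def IsVertexIndex (H : HalfspaceSystem d n) (I : Finset (Fin n)) : Prop :=
  ∃ x ∈ H.polytope.extremePoints ℝ, H.tight x = I

variable {H : HalfspaceSystem d n} {I K : Finset (Fin n)} {x y z : EuclideanSpace ℝ (Fin d)}

@[simp] theorem mem_tight {j : Fin n} :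
    j ∈ H.tight x ↔ inner ℝ (H.normal j) x = H.offset j := by simp [tight]

theorem mem_facet_iff {j : Fin n} (hx : x ∈ H.polytope) : x ∈ H.facet j ↔ j ∈ H.tight x := by
  simp [facet, hyperplane, hx]

theorem Spans.mono (h : H.Spans I) (hIK : I ⊆ K) : H.Spans K :=
  fun r hr => h r fun j hj => hr j (hIK hj)

theorem inner_lt_of_not_mem_tight {j : Fin n} (hx : x ∈ H.polytope) (hj : j ∉ H.tight x) :
    inner ℝ (H.normal j) x < H.offset j :=
  lt_of_le_of_ne (hx j) fun h => hj (mem_tight.2 h)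

theorem convex_polytope (H : HalfspaceSystem d n) : Convex ℝ H.polytope := by
  intro x hx y hy a b ha hb hab j
  rw [inner_add_right, inner_smul_right, inner_smul_right]
  calc a * inner ℝ (H.normal j) x + b * inner ℝ (H.normal j) y
      ≤ a * H.offset j + b * H.offset j :=
        add_le_add (mul_le_mul_of_nonneg_left (hx j) ha) (mul_le_mul_of_nonneg_left (hy j) hb)
    _ = H.offset j := by rw [← add_mul, hab, one_mul]

theorem isClosed_polytope (H : HalfspaceSystem d n) : IsClosed H.polytope := by
  have : H.polytope = ⋂ j, {x | inner ℝ (H.normal j) x ≤ H.offset j} := by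
    ext x; simp [polytope]
  rw [this]
  exact isClosed_iInter fun j => isClosed_le (by fun_prop) continuous_const

/-- The face cut out by the facets with indices in `I`. -/
def face (H : HalfspaceSystem d n) (I : Finset (Fin n)) : Set (EuclideanSpace ℝ (Fin d)) :=
  {z ∈ H.polytope | I ⊆ H.tight z}

/-- The sum of the normals in `I` exposes the face: a sum of inequalities is an equality only if
each of them is. A point of the face is needed to know that the maximum is attained. -/
theorem isExposed_face (H : HalfspaceSystem d n) (I : Finset (Fin n)) :
    IsExposed ℝ H.polytope (H.face I) := by
  rintro ⟨w, hw, hwI⟩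
  have key : ∀ z ∈ H.polytope, ∑ j ∈ I, inner ℝ (H.normal j) z ≤ ∑ j ∈ I, H.offset j :=
    fun z hz => Finset.sum_le_sum fun j _ => hz j
  have hws : ∑ j ∈ I, inner ℝ (H.normal j) w = ∑ j ∈ I, H.offset j :=
    Finset.sum_congr rfl fun j hj => mem_tight.1 (hwI hj)
  refine ⟨∑ j ∈ I, innerSL ℝ (H.normal j), ?_⟩
  ext z
  simp only [face, Set.mem_ofPred_eq, sum_apply, innerSL_apply_apply]
  constructor
  · rintro ⟨hz, hzI⟩
    refine ⟨hz, fun y hy => ?_⟩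
    rw [Finset.sum_congr rfl fun j hj => mem_tight.1 (hzI hj)]
    exact key y hy
  · rintro ⟨hz, hzm⟩
    refine ⟨hz, fun j hj => mem_tight.2 ?_⟩
    have h1 := (key z hz).antisymm (hws ▸ hzm w hw)
    exact (Finset.sum_eq_sum_iff_of_le fun j _ => hz j).1 h1 j hj

theorem isCompact_polytope (hb : Bornology.IsBounded H.polytope) : IsCompact H.polytope :=
  Metric.isCompact_of_isClosed_isBounded H.isClosed_polytope hb

/-- A compact nonempty face has an extreme point, which is extreme in the whole polytope. This turns
points on given facets, as produced by perturbation or limits, into vertices. -/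
theorem exists_vertex_of_face_nonempty (hb : Bornology.IsBounded H.polytope)
    (hz : z ∈ H.polytope) (hI : I ⊆ H.tight z) :
    ∃ x ∈ H.polytope.extremePoints ℝ, I ⊆ H.tight x := by
  have hc : IsCompact (H.face I) := (H.isExposed_face I).isCompact (isCompact_polytope hb)
  obtain ⟨x, hx⟩ := hc.extremePoints_nonempty ⟨z, hz, hI⟩
  exact ⟨x, (H.isExposed_face I).isExtreme.extremePoints_subset_extremePoints hx, hx.1.2⟩

/-- A face with at least two points has a vertex other than a given one. -/
theorem exists_vertex_ne (hb : Bornology.IsBounded H.polytope) (u : EuclideanSpace ℝ (Fin d))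
    (hz : z ∈ H.polytope) (hI : I ⊆ H.tight z) (hzu : z ≠ u) :
    ∃ x ∈ H.polytope.extremePoints ℝ, I ⊆ H.tight x ∧ x ≠ u := by
  have hc : IsCompact (H.face I) := (H.isExposed_face I).isCompact (isCompact_polytope hb)
  have hconv : Convex ℝ (H.face I) := (H.isExposed_face I).convex H.convex_polytope
  by_contra! hcon
  -- By Krein–Milman, a face with `u` as its only vertex would be `{u}`.
  have hsub : (H.face I).extremePoints ℝ ⊆ {u} := fun x hx =>
    hcon x ((H.isExposed_face I).isExtreme.extremePoints_subset_extremePoints hx) hx.1.2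
  have h1 : H.face I ⊆ {u} := by
    rw [← closure_convexHull_extremePoints hc hconv]
    exact closure_minimal (convexHull_min hsub (convex_singleton u)) isClosed_singleton
  exact hzu (h1 ⟨hz, hI⟩)

theorem exists_add_sub_mem {r : EuclideanSpace ℝ (Fin d)} (hx : x ∈ H.polytope)
    (hr : ∀ j ∈ H.tight x, inner ℝ (H.normal j) r = 0) :
    ∃ ε > (0 : ℝ), x + ε • r ∈ H.polytope ∧ x - ε • r ∈ H.polytope := by
  have h : ∀ᶠ s in 𝓝 (0 : ℝ), x + s • r ∈ H.polytope := by
    have : ∀ j, ∀ᶠ s in 𝓝 (0 : ℝ), inner ℝ (H.normal j) (x + s • r) ≤ H.offset j := by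
      intro j
      by_cases hj : j ∈ H.tight x
      · refine Eventually.of_forall fun s => ?_
        rw [inner_add_right, inner_smul_right, hr j hj, mul_zero, add_zero]
        exact hx j
      · have hlt := inner_lt_of_not_mem_tight hx hj
        have hcont : ContinuousAt (fun s : ℝ => inner ℝ (H.normal j) (x + s • r)) 0 := by
          fun_prop
        exact (hcont.eventually_lt continuousAt_const (by simpa using hlt)).mono fun s hs => hs.le
    exact eventually_all.2 this
  have h2 : ∀ᶠ s in 𝓝 (0 : ℝ), x - s • r ∈ H.polytope := by
    have := (continuous_neg.tendsto' (0 : ℝ) 0 neg_zero).eventually h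
    exact this.mono fun s hs => by simpa [sub_eq_add_neg] using hs
  obtain ⟨ε, h3, hε⟩ := (((h.and h2).filter_mono (nhdsWithin_le_nhds (s := Set.Ioi 0))).and
    self_mem_nhdsWithin).exists
  exact ⟨ε, hε, h3⟩

theorem mem_openSegment_add_sub (x r : EuclideanSpace ℝ (Fin d)) :
    x ∈ openSegment ℝ (x + r) (x - r) :=
  ⟨1 / 2, 1 / 2, by norm_num, by norm_num, by norm_num, by module⟩

/-- A direction orthogonal to all active normals can be followed both ways for a short time, since
the inactive constraints are strict. Conversely, a segment around `x` stays inside every active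
hyperplane. -/
theorem mem_extremePoints_iff_spans :
    x ∈ H.polytope.extremePoints ℝ ↔ x ∈ H.polytope ∧ H.Spans (H.tight x) := by
  constructor
  · intro hx
    refine ⟨hx.1, fun r hr => ?_⟩
    obtain ⟨ε, hε, h1, h2⟩ := exists_add_sub_mem hx.1 hr
    have := hx.2 h1 h2 (mem_openSegment_add_sub x _)
    simpa [hε.ne'] using this
  · rintro ⟨hx, hs⟩
    refine ⟨hx, fun y hy z hz hxyz => ?_⟩
    have hyx : ∀ j ∈ H.tight x, inner ℝ (H.normal j) (y - x) = 0 := by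
      intro j hj
      have he : x ∈ H.face {j} := ⟨hx, by simpa using hj⟩
      have := ((H.isExposed_face {j}).isExtreme.left_mem_of_mem_openSegment hy hz he hxyz).2
      rw [inner_sub_right, mem_tight.1 hj, mem_tight.1 (this (Finset.mem_singleton_self j)),
        sub_self]
    exact sub_eq_zero.1 (hs _ hyx)

theorem mem_extremePoints_of_spans (hx : x ∈ H.polytope) (hI : H.Spans I) (h : I ⊆ H.tight x) :
    x ∈ H.polytope.extremePoints ℝ :=
  mem_extremePoints_iff_spans.2 ⟨hx, hI.mono h⟩

theorem eq_of_spans (hI : H.Spans I) (hx : I ⊆ H.tight x) (hy : I ⊆ H.tight y) : x = y :=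
  sub_eq_zero.1 <| hI _ fun j hj => by
    rw [inner_sub_right, mem_tight.1 (hx hj), mem_tight.1 (hy hj), sub_self]

theorem eq_of_tight_subset (hx : x ∈ H.polytope.extremePoints ℝ) (h : H.tight x ⊆ H.tight y) :
    x = y :=
  eq_of_spans (mem_extremePoints_iff_spans.1 hx).2 subset_rfl h

/-- Pairing with the normals indexed by `I`. -/
noncomputable def pairing (H : HalfspaceSystem d n) (I : Finset (Fin n)) :
    EuclideanSpace ℝ (Fin d) →ₗ[ℝ] (I → ℝ) :=
  LinearMap.pi fun j => (innerSL ℝ (H.normal j)).toLinearMap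

@[simp] theorem pairing_apply (r : EuclideanSpace ℝ (Fin d)) (j : I) :
    H.pairing I r j = inner ℝ (H.normal j) r := rfl

theorem exists_ne_zero_of_card_lt (v : EuclideanSpace ℝ (Fin d)) (h : I.card + 1 < d) :
    ∃ r ≠ 0, (∀ j ∈ I, inner ℝ (H.normal j) r = 0) ∧ inner ℝ v r = 0 := by
  have hk := LinearMap.ker_ne_bot_of_finrank_lt
    (f := (H.pairing I).prod (innerSL ℝ v).toLinearMap) (by simpa using h)
  obtain ⟨r, hr, hr0⟩ := (Submodule.ne_bot_iff _).1 hk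
  rw [LinearMap.mem_ker] at hr
  have h1 : H.pairing I r = 0 := congrArg Prod.fst hr
  have h2 : inner ℝ v r = 0 := congrArg Prod.snd hr
  exact ⟨r, hr0, fun j hj => congrFun h1 ⟨j, hj⟩, h2⟩

theorem exists_ne_zero_of_card_lt' (h : I.card < d) :
    ∃ r ≠ 0, ∀ j ∈ I, inner ℝ (H.normal j) r = 0 := by
  have hk := LinearMap.ker_ne_bot_of_finrank_lt (f := H.pairing I) (by simpa using h)
  obtain ⟨r, hr, hr0⟩ := (Submodule.ne_bot_iff _).1 hk
  rw [LinearMap.mem_ker] at hr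
  exact ⟨r, hr0, fun j hj => congrFun hr ⟨j, hj⟩⟩

theorem Spans.le_card (hI : H.Spans I) : d ≤ I.card := by
  by_contra! h
  obtain ⟨r, hr0, hr⟩ := exists_ne_zero_of_card_lt' (H := H) h
  exact hr0 (hI r hr)

theorem Spans.exists_inner_eq (hI : H.Spans I) (hc : I.card = d) (f : Fin n → ℝ) :
    ∃ r, ∀ j ∈ I, inner ℝ (H.normal j) r = f j := by
  have hinj : Function.Injective (H.pairing I) := by
    rw [← LinearMap.ker_eq_bot, Submodule.eq_bot_iff]
    intro r hr
    rw [LinearMap.mem_ker] at hr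
    exact hI r fun j hj => congrFun hr ⟨j, hj⟩
  have hsurj := (LinearMap.injective_iff_surjective_of_finrank_eq_finrank
    (by simpa using hc.symm)).1 hinj
  obtain ⟨r, hr⟩ := hsurj fun j => f j
  exact ⟨r, fun j hj => congrFun hr ⟨j, hj⟩⟩

/-- The direction of the ray along which exactly the facet `j` of a simple vertex is left. -/
theorem Spans.exists_ray (hI : H.Spans I) (hc : I.card = d) (j : Fin n) :
    ∃ r, ∀ m ∈ I, inner ℝ (H.normal m) r = if m = j then -1 else 0 :=
  hI.exists_inner_eq hc fun m => if m = j then -1 else 0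

theorem isSimple_iff :
    H.IsSimple ↔ ∀ x ∈ H.polytope.extremePoints ℝ, (H.tight x).card = d := by
  refine forall₂_congr fun x hx => ?_
  have : {j | x ∈ H.facet j} = (H.tight x : Set (Fin n)) := by
    ext j; simp [mem_facet_iff hx.1]
  rw [this, Set.ncard_coe_finset]

theorem IsSimple.card_tight_le (hs : H.IsSimple) (hb : Bornology.IsBounded H.polytope)
    (hx : x ∈ H.polytope) : (H.tight x).card ≤ d := by
  obtain ⟨y, hy, hxy⟩ := exists_vertex_of_face_nonempty hb hx subset_rfl
  exact (Finset.card_le_card hxy).trans (isSimple_iff.1 hs y hy).le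

theorem IsVertexIndex.card_eq (hs : H.IsSimple) (h : H.IsVertexIndex I) : I.card = d := by
  obtain ⟨x, hx, rfl⟩ := h
  exact isSimple_iff.1 hs x hx

/-- The face on `I` has a vertex, and simplicity leaves no room for a further facet through it. -/
theorem IsSimple.isVertexIndex (hs : H.IsSimple) (hb : Bornology.IsBounded H.polytope)
    (hx : x ∈ H.polytope) (hI : I ⊆ H.tight x) (hc : I.card = d) : H.IsVertexIndex I := by
  obtain ⟨y, hy, hxy⟩ := exists_vertex_of_face_nonempty hb hx hI
  exact ⟨y, hy, (Finset.eq_of_subset_of_card_le hxy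
    (by rw [hc, isSimple_iff.1 hs y hy])).symm⟩

/-- In a simple polytope, a face on `d - 1` facets through two vertices is their segment. -/
theorem face_eq_segment (hs : H.IsSimple) (hx : x ∈ H.polytope.extremePoints ℝ)
    (hy : y ∈ H.polytope.extremePoints ℝ) (hxy : x ≠ y) (hKx : K ⊆ H.tight x) (hKy : K ⊆ H.tight y)
    (hK : d ≤ K.card + 1) : H.face K = segment ℝ x y := by
  have hcx := isSimple_iff.1 hs x hx
  have hlt : K ⊂ H.tight x := by
    refine Finset.ssubset_iff_subset_ne.2 ⟨hKx, fun h => hxy ?_⟩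
    exact eq_of_tight_subset hx (h ▸ hKy)
  obtain ⟨j, hjx, hjK⟩ := Finset.exists_of_ssubset hlt
  have hins : H.tight x ⊆ insert j K := by
    have h1 : insert j K ⊆ H.tight x := Finset.insert_subset hjx hKx
    rw [Finset.eq_of_subset_of_card_le h1
      (by rw [Finset.card_insert_of_notMem hjK, hcx]; exact hK)]
  have hsx := (mem_extremePoints_iff_spans.1 hx).2
  -- The active normals at `x` are those of `K` and `j`; on the hyperplanes of `K` a point is
  -- determined by its pairing with the normal `j`.
  have hpar : ∀ z, K ⊆ H.tight z → ∃ c : ℝ, z = x + c • (y - x) := by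
    intro z hz
    have hKd : ∀ p, K ⊆ H.tight p → ∀ m ∈ K, inner ℝ (H.normal m) (p - x) = 0 := by
      intro p hp m hm
      rw [inner_sub_right, mem_tight.1 (hp hm), mem_tight.1 (hKx hm), sub_self]
    have hne : inner ℝ (H.normal j) (y - x) ≠ 0 := by
      intro h0
      refine hxy (sub_eq_zero.1 (hsx (y - x) fun m hm => ?_)).symm
      rcases Finset.mem_insert.1 (hins hm) with rfl | hm
      · exact h0
      · exact hKd y hKy m hm
    refine ⟨inner ℝ (H.normal j) (z - x) / inner ℝ (H.normal j) (y - x), ?_⟩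
    have := hsx (z - x - (inner ℝ (H.normal j) (z - x) / inner ℝ (H.normal j) (y - x)) • (y - x))
      fun m hm => by
        rw [inner_sub_right, inner_smul_right]
        rcases Finset.mem_insert.1 (hins hm) with rfl | hm
        · field_simp; ring
        · rw [hKd y hKy m hm, hKd z hz m hm]; simp
    rw [sub_eq_zero, sub_eq_iff_eq_add'] at this
    exact this
  apply Set.Subset.antisymm
  · rintro z ⟨hz, hzK⟩
    obtain ⟨c, rfl⟩ := hpar z hzK
    -- Beyond an end of the segment, that end would be an interior point of a segment of the
    -- polytope, against its extremality.
    have hc0 : 0 ≤ c := by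
      by_contra! hc
      have hpos : 0 < 1 - c := by linarith
      have hx' : x ∈ openSegment ℝ (x + c • (y - x)) y := by
        refine ⟨1 / (1 - c), -c / (1 - c), by positivity, div_pos (by linarith) hpos,
          by field_simp; ring, ?_⟩
        have h1 : (1 / (1 - c)) * (1 - c) = 1 := by field_simp
        have h2 : (1 / (1 - c)) * c + (-c / (1 - c)) = 0 := by field_simp; ring
        calc _ = ((1 / (1 - c)) * (1 - c)) • x + ((1 / (1 - c)) * c + (-c / (1 - c))) • y := by
              module
          _ = x := by rw [h1, h2]; simp
      exact hxy ((mem_extremePoints.1 hx).2 _ hz _ hy.1 hx').2.symm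
    have hc1 : c ≤ 1 := by
      by_contra! hc
      have hpos : 0 < c := by linarith
      have hy' : y ∈ openSegment ℝ x (x + c • (y - x)) := by
        refine ⟨(c - 1) / c, 1 / c, div_pos (by linarith) hpos, by positivity,
          by field_simp; ring, ?_⟩
        have h1 : (c - 1) / c + 1 / c * (1 - c) = 0 := by field_simp; ring
        have h2 : 1 / c * c = 1 := by field_simp
        calc _ = ((c - 1) / c + 1 / c * (1 - c)) • x + (1 / c * c) • y := by module
          _ = y := by rw [h1, h2]; simp
      exact hxy ((mem_extremePoints.1 hy).2 _ hx.1 _ hz hy').1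
    exact ⟨1 - c, c, by linarith, hc0, by ring, by module⟩
  · exact ((H.isExposed_face K).convex H.convex_polytope).segment_subset ⟨hx.1, hKx⟩ ⟨hy.1, hKy⟩

theorem tight_inter_subset {a b : ℝ} (hab : a + b = 1) :
    H.tight x ∩ H.tight y ⊆ H.tight (a • x + b • y) := by
  intro j hj
  simp only [Finset.mem_inter, mem_tight] at hj ⊢
  rw [inner_add_right, inner_smul_right, inner_smul_right, hj.1, hj.2, ← add_mul, hab, one_mul]

theorem segment_subset_facet_iff {j : Fin n} (hx : x ∈ H.polytope) (hy : y ∈ H.polytope) :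
    segment ℝ x y ⊆ H.facet j ↔ j ∈ H.tight x ∩ H.tight y := by
  rw [Finset.mem_inter, ← mem_facet_iff hx, ← mem_facet_iff hy]
  constructor
  · exact fun h => ⟨h (left_mem_segment ℝ x y), h (right_mem_segment ℝ x y)⟩
  · rintro ⟨h1, h2⟩
    rintro _ ⟨a, b, ha, hb, hab, rfl⟩
    refine ⟨H.convex_polytope hx hy ha hb hab, mem_tight.1 (tight_inter_subset hab ?_)⟩
    exact Finset.mem_inter.2 ⟨(mem_facet_iff hx).1 h1, (mem_facet_iff hy).1 h2⟩

theorem eq_or_eq_of_mem_segment {P : Set (EuclideanSpace ℝ (Fin d))} (hz : z ∈ P.extremePoints ℝ)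
    (hx : x ∈ P) (hy : y ∈ P) (h : z ∈ segment ℝ x y) : z = x ∨ z = y := by
  rcases (mem_extremePoints_iff_forall_segment.1 hz).2 x hx y hy h with h | h
  · exact Or.inl h.symm
  · exact Or.inr h.symm

/-- The ends of an edge. -/
theorem _root_.IsPolytopeEdge.ends {P : Set (EuclideanSpace ℝ (Fin d))}
    (h : IsPolytopeEdge P (segment ℝ x y)) :
    x ∈ P.extremePoints ℝ ∧ y ∈ P.extremePoints ℝ ∧ x ≠ y := by
  obtain ⟨he, a, ha, b, hb, hab, hseg⟩ := h
  have hsub := he.subset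
  have hx := hsub (left_mem_segment ℝ x y)
  have hy := hsub (right_mem_segment ℝ x y)
  have h1 := eq_or_eq_of_mem_segment ha hx hy (hseg ▸ left_mem_segment ℝ a b)
  have h2 := eq_or_eq_of_mem_segment hb hx hy (hseg ▸ right_mem_segment ℝ a b)
  rcases h1 with rfl | rfl <;> rcases h2 with rfl | rfl
  · exact absurd rfl hab
  · exact ⟨ha, hb, hab⟩
  · exact ⟨hb, ha, hab.symm⟩
  · exact absurd rfl hab

theorem _root_.segment_eq_segment_of_mem_extremePoints {P : Set (EuclideanSpace ℝ (Fin d))}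
    {v w : EuclideanSpace ℝ (Fin d)}
    (hx : x ∈ P.extremePoints ℝ) (hy : y ∈ P.extremePoints ℝ) (hxy : x ≠ y)
    (hv : v ∈ P) (hw : w ∈ P) (h : segment ℝ v w = segment ℝ x y) :
    (v = x ∧ w = y) ∨ (v = y ∧ w = x) := by
  have h1 := eq_or_eq_of_mem_segment hx hv hw (h ▸ left_mem_segment ℝ x y)
  have h2 := eq_or_eq_of_mem_segment hy hv hw (h ▸ right_mem_segment ℝ x y)
  rcases h1 with rfl | rfl <;> rcases h2 with rfl | rfl
  · exact absurd rfl hxy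
  · exact Or.inl ⟨rfl, rfl⟩
  · exact Or.inr ⟨rfl, rfl⟩
  · exact absurd rfl hxy

/-- In a simple polytope two vertices are adjacent iff they share `d - 1` facets. -/
theorem isPolytopeEdge_segment_iff (hs : H.IsSimple) (hx : x ∈ H.polytope.extremePoints ℝ)
    (hy : y ∈ H.polytope.extremePoints ℝ) (hxy : x ≠ y) :
    IsPolytopeEdge H.polytope (segment ℝ x y) ↔ d ≤ (H.tight x ∩ H.tight y).card + 1 := by
  constructor
  · rintro ⟨he, -⟩
    by_contra! hcard
    -- With too few common facets there is a direction `r ≠ 0` orthogonal to the active normals at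
    -- the midpoint and to `y - x`. Moving along `r` stays in the polytope, hence in the exposed
    -- segment, so `r` is also parallel to `y - x`.
    set m : EuclideanSpace ℝ (Fin d) := (1 / 2 : ℝ) • x + (1 / 2 : ℝ) • y with hm
    have hmseg : m ∈ segment ℝ x y := ⟨1 / 2, 1 / 2, by norm_num, by norm_num, by norm_num, rfl⟩
    have hmP : m ∈ H.polytope := he.subset hmseg
    have htm : H.tight m ⊆ H.tight x ∩ H.tight y := by
      intro j hj
      have hj' := mem_tight.1 hj
      have h1 := hx.1 j
      have h2 := hy.1 j
      rw [hm, inner_add_right, inner_smul_right, inner_smul_right] at hj'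
      rw [Finset.mem_inter, mem_tight, mem_tight]
      constructor <;> linarith
    obtain ⟨r, hr0, hr, hrv⟩ := exists_ne_zero_of_card_lt (H := H) (y - x)
      (lt_of_le_of_lt (Nat.succ_le_succ (Finset.card_le_card htm)) hcard)
    obtain ⟨ε, hε, h1, h2⟩ := exists_add_sub_mem hmP hr
    have h3 := he.isExtreme.left_mem_of_mem_openSegment h1 h2 hmseg (mem_openSegment_add_sub m _)
    obtain ⟨a, b, ha, hb, hab, h4⟩ := h3
    have h5 : ε • r = (b - 1 / 2) • (y - x) := by
      have : ε • r = a • x + b • y - m := by rw [h4]; abel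
      rw [this, hm]
      obtain rfl : a = 1 - b := by linarith
      module
    have h6 : inner ℝ r (ε • r) = 0 := by
      rw [h5, inner_smul_right, real_inner_comm, hrv, mul_zero]
    rw [inner_smul_right, mul_eq_zero, inner_self_eq_zero] at h6
    exact h6.elim hε.ne' hr0
  · intro h
    refine ⟨?_, x, hx, y, hy, hxy, rfl⟩
    rw [← face_eq_segment hs hx hy hxy Finset.inter_subset_left Finset.inter_subset_right h]
    exact H.isExposed_face _

end HalfspaceSystem

/-! ### Persistence of faces and vertices along the deformation. -/

namespace IsFundamentalDeformation


variable {d n : ℕ} {S : ℝ → HalfspaceSystem d n} {i : Fin n}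
  {I : Finset (Fin n)} {y : EuclideanSpace ℝ (Fin d)} {s t : ℝ}

theorem normal_eq (hS : IsFundamentalDeformation S i) (ht : t ∈ Set.Icc (0 : ℝ) 1)
    (hs : s ∈ Set.Icc (0 : ℝ) 1) {j : Fin n} (hj : j ≠ i) : (S t).normal j = (S s).normal j := by
  rw [hS.normal_fixed t ht j hj, hS.normal_fixed s hs j hj]

theorem offset_eq (hS : IsFundamentalDeformation S i) (ht : t ∈ Set.Icc (0 : ℝ) 1)
    (hs : s ∈ Set.Icc (0 : ℝ) 1) {j : Fin n} (hj : j ≠ i) : (S t).offset j = (S s).offset j := by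
  rw [hS.offset_fixed t ht j hj, hS.offset_fixed s hs j hj]

theorem continuousOn_normal (hS : IsFundamentalDeformation S i) (j : Fin n) :
    ContinuousOn (fun t => (S t).normal j) (Set.Icc 0 1) := by
  by_cases hj : j = i
  · exact hj ▸ hS.continuous_normal
  · exact continuousOn_const.congr fun t ht => hS.normal_fixed t ht j hj

theorem continuousOn_offset (hS : IsFundamentalDeformation S i) (j : Fin n) :
    ContinuousOn (fun t => (S t).offset j) (Set.Icc 0 1) := by
  by_cases hj : j = i
  · exact hj ▸ hS.continuous_offset
  · exact continuousOn_const.congr fun t ht => hS.offset_fixed t ht j hj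

theorem mem_tight_iff (hS : IsFundamentalDeformation S i) (ht : t ∈ Set.Icc (0 : ℝ) 1)
    (hs : s ∈ Set.Icc (0 : ℝ) 1) {j : Fin n} (hj : j ≠ i) :
    j ∈ (S t).tight y ↔ j ∈ (S s).tight y := by
  rw [mem_tight, mem_tight, hS.normal_eq ht hs hj, hS.offset_eq ht hs hj]

theorem spans_of_notMem (hS : IsFundamentalDeformation S i) (ht : t ∈ Set.Icc (0 : ℝ) 1)
    (hs : s ∈ Set.Icc (0 : ℝ) 1) (hi : i ∉ I) (h : (S s).Spans I) : (S t).Spans I :=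
  fun r hr => h r fun j hj => by
    rw [← hS.normal_eq ht hs (ne_of_mem_of_not_mem hj hi)]; exact hr j hj

theorem subset_of_le (hS : IsFundamentalDeformation S i) (hs : s ∈ Set.Icc (0 : ℝ) 1)
    (ht : t ∈ Set.Icc (0 : ℝ) 1) (hst : s ≤ t) : (S t).polytope ⊆ (S s).polytope := by
  rcases hst.eq_or_lt with rfl | h
  · exact subset_rfl
  · exact hS.decreasing s hs t ht h

/-- The point of the line `y + ℝ r` on the moving hyperplane is, shortly before and after `s`,
strictly inside the half-spaces that have `y` in their interior. -/
theorem eventually_shift (hS : IsFundamentalDeformation S i) (hs : s ∈ Set.Icc (0 : ℝ) 1)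
    (hy : y ∈ (S s).polytope) (hi : i ∈ (S s).tight y) {r : EuclideanSpace ℝ (Fin d)}
    (hr : inner ℝ ((S s).normal i) r ≠ 0) :
    ∀ᶠ t in 𝓝[Set.Icc 0 1] s,
      0 < inner ℝ ((S t).normal i) r * inner ℝ ((S s).normal i) r ∧
      ∀ j ∉ (S s).tight y, inner ℝ ((S t).normal j)
        (y + (((S t).offset i - inner ℝ ((S t).normal i) y) / inner ℝ ((S t).normal i) r) • r)
          < (S t).offset j := by
  have hN : ∀ j, ContinuousWithinAt (fun t => (S t).normal j) (Set.Icc 0 1) s :=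
    fun j => hS.continuousOn_normal j s hs
  have hB : ∀ j, ContinuousWithinAt (fun t => (S t).offset j) (Set.Icc 0 1) s :=
    fun j => hS.continuousOn_offset j s hs
  have hNr : ContinuousWithinAt (fun t => inner ℝ ((S t).normal i) r) (Set.Icc 0 1) s :=
    (hN i).inner continuousWithinAt_const
  refine Eventually.and ?_ (eventually_all.2 fun j => ?_)
  · refine (ContinuousWithinAt.mul hNr continuousWithinAt_const).eventually_const_lt ?_
    exact mul_self_pos.2 hr
  · by_cases hj : j ∈ (S s).tight y
    · exact Eventually.of_forall fun t h => absurd hj h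
    · have hc : ContinuousWithinAt (fun t => inner ℝ ((S t).normal j)
          (y + (((S t).offset i - inner ℝ ((S t).normal i) y) / inner ℝ ((S t).normal i) r) • r))
          (Set.Icc 0 1) s := by
        have hq : ContinuousWithinAt (fun t =>
            ((S t).offset i - inner ℝ ((S t).normal i) y) / inner ℝ ((S t).normal i) r)
            (Set.Icc 0 1) s := ((hB i).sub ((hN i).inner continuousWithinAt_const)).div hNr hr
        refine (hN j).inner ?_
        fun_prop
      refine (hc.tendsto.eventually_lt (hB j).tendsto ?_).mono fun t ht _ => ht
      -- At time `s` the shift coefficient is zero and the point is `y` itself.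
      rw [mem_tight.1 hi]
      simpa using inner_lt_of_not_mem_tight hy hj

theorem inner_shift {H : HalfspaceSystem d n} {r : EuclideanSpace ℝ (Fin d)}
    (hr : inner ℝ (H.normal i) r ≠ 0) :
    inner ℝ (H.normal i)
      (y + ((H.offset i - inner ℝ (H.normal i) y) / inner ℝ (H.normal i) r) • r)
      = H.offset i := by
  rw [inner_add_right, inner_smul_right]
  field_simp
  ring

/-- Nonempty faces persist if the moving hyperplane is transversal to the fixed ones. -/
theorem eventually_exists_tight (hS : IsFundamentalDeformation S i) (hs : s ∈ Set.Icc (0 : ℝ) 1)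
    (hy : y ∈ (S s).polytope)
    (h : i ∈ (S s).tight y → ∃ r, (∀ j ∈ (S s).tight y, j ≠ i → inner ℝ ((S s).normal j) r = 0) ∧
      inner ℝ ((S s).normal i) r ≠ 0) :
    ∀ᶠ t in 𝓝[Set.Icc 0 1] s, ∃ z ∈ (S t).polytope, (S s).tight y ⊆ (S t).tight z := by
  by_cases hi : i ∈ (S s).tight y
  -- Moving along `r` stays on the fixed hyperplanes through `y`, and the amount is chosen to return
  -- to `π_i(t)`.
  · obtain ⟨r, hr, hri⟩ := h hi
    filter_upwards [hS.eventually_shift hs hy hi hri, self_mem_nhdsWithin] with t ⟨ht1, ht2⟩ ht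
    have hne : inner ℝ ((S t).normal i) r ≠ 0 := left_ne_zero_of_mul ht1.ne'
    have htight : ∀ j ∈ (S s).tight y, inner ℝ ((S t).normal j)
        (y + (((S t).offset i - inner ℝ ((S t).normal i) y) / inner ℝ ((S t).normal i) r) • r)
          = (S t).offset j := by
      intro j hj
      by_cases hji : j = i
      · rw [hji]; exact inner_shift hne
      · rw [inner_add_right, inner_smul_right, hS.normal_eq ht hs hji, hr j hj hji, mul_zero,
          add_zero, hS.offset_eq ht hs hji, mem_tight.1 hj]
    refine ⟨_, fun j => ?_, fun j hj => mem_tight.2 (htight j hj)⟩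
    by_cases hj : j ∈ (S s).tight y
    · exact (htight j hj).le
    · exact (ht2 j hj).le
  · have hlt : ∀ᶠ t in 𝓝[Set.Icc 0 1] s, inner ℝ ((S t).normal i) y < (S t).offset i :=
      ((hS.continuousOn_normal i s hs).inner continuousWithinAt_const).tendsto.eventually_lt
        (hS.continuousOn_offset i s hs).tendsto (inner_lt_of_not_mem_tight hy hi)
    filter_upwards [hlt, self_mem_nhdsWithin] with t hti ht
    refine ⟨y, fun j => ?_, fun j hj => ?_⟩
    · by_cases hji : j = i
      · exact hji ▸ hti.le
      · rw [hS.normal_eq ht hs hji, hS.offset_eq ht hs hji]; exact hy j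
    · have hji : j ≠ i := fun h => hi (h ▸ hj)
      exact (hS.mem_tight_iff ht hs hji).2 hj

/-- At a vertex on exactly `d` facets the normals are independent, so the ray leaving only `π_i` is
the transversal direction required. -/
theorem eventually_exists_of_isVertexIndex (hS : IsFundamentalDeformation S i)
    (hs : s ∈ Set.Icc (0 : ℝ) 1) (h : (S s).IsVertexIndex I) (hI : I.card = d) :
    ∀ᶠ t in 𝓝[Set.Icc 0 1] s, ∃ z ∈ (S t).polytope, I ⊆ (S t).tight z := by
  obtain ⟨y, hy, rfl⟩ := h
  refine hS.eventually_exists_tight hs hy.1 fun hi => ?_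
  obtain ⟨r, hr⟩ := (mem_extremePoints_iff_spans.1 hy).2.exists_ray hI i
  refine ⟨r, fun j hj hji => ?_, ?_⟩
  · simpa [hji] using hr j hj
  · rw [hr i hi]; simp

/-- Limits of points on given facets lie on these facets. -/
theorem exists_of_frequently (hS : IsFundamentalDeformation S i) (hs : s ∈ Set.Icc (0 : ℝ) 1)
    (h : ∃ᶠ t in 𝓝[Set.Icc 0 1] s, ∃ z ∈ (S t).polytope, I ⊆ (S t).tight z) :
    ∃ z ∈ (S s).polytope, I ⊆ (S s).tight z := by
  have h0 : (0 : ℝ) ∈ Set.Icc (0 : ℝ) 1 := by simp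
  rw [Filter.frequently_iff_neBot] at h
  -- An ultrafilter replaces the choice of a convergent subsequence; the chosen points all lie in
  -- the compact `P(0)`.
  obtain ⟨F, hF⟩ := Ultrafilter.exists_le (𝓝[Set.Icc 0 1] s ⊓
    𝓟 {t | ∃ z ∈ (S t).polytope, I ⊆ (S t).tight z})
  have hFs : (F : Filter ℝ) ≤ 𝓝[Set.Icc 0 1] s := hF.trans inf_le_left
  have hF1 : ∀ᶠ t in (F : Filter ℝ), t ∈ Set.Icc (0 : ℝ) 1 := hFs self_mem_nhdsWithin
  have hF2 : ∀ᶠ t in (F : Filter ℝ), ∃ z ∈ (S t).polytope, I ⊆ (S t).tight z :=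
    hF.trans inf_le_right (mem_principal_self _)
  obtain ⟨z, hz⟩ := hF2.choice
  have hz0 : ∀ᶠ t in (F : Filter ℝ), z t ∈ (S 0).polytope := by
    filter_upwards [hF1, hz] with t ht hzt
    exact hS.subset_of_le h0 ht ht.1 hzt.1
  obtain ⟨x, -, hx⟩ := (isCompact_polytope (hS.presents 0 h0).isBounded).ultrafilter_le_nhds
    (F.map z) (by rw [Ultrafilter.coe_map]; exact tendsto_principal.2 hz0)
  have hx' : Tendsto z F (𝓝 x) := hx
  have hN : ∀ j, Tendsto (fun t => inner ℝ ((S t).normal j) (z t)) F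
      (𝓝 (inner ℝ ((S s).normal j) x)) := fun j =>
    ((hS.continuousOn_normal j s hs).tendsto.mono_left hFs).inner hx'
  have hB : ∀ j, Tendsto (fun t => (S t).offset j) F (𝓝 ((S s).offset j)) := fun j =>
    (hS.continuousOn_offset j s hs).tendsto.mono_left hFs
  refine ⟨x, fun j => le_of_tendsto_of_tendsto (hN j) (hB j) ?_, fun j hj => mem_tight.2 ?_⟩
  · filter_upwards [hz] with t ht using ht.1 j
  · refine tendsto_nhds_unique_of_eventuallyEq (hN j) (hB j) ?_
    filter_upwards [hz] with t ht using mem_tight.1 (ht.2 hj)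

/-- While the polytope stays simple, its vertices keep their sets of facets. -/
theorem isVertexIndex_of_isPreconnected (hS : IsFundamentalDeformation S i) {U : Set ℝ}
    (hU : IsPreconnected U) (hU1 : U ⊆ Set.Icc 0 1) (hsimple : ∀ t ∈ U, (S t).IsSimple)
    (hs : s ∈ U) (ht : t ∈ U) (h : (S s).IsVertexIndex I) : (S t).IsVertexIndex I := by
  have hI := h.card_eq (hsimple s hs)
  -- By connectedness, it suffices to compare nearby times in both directions. From `a` to `b` this
  -- is persistence; from `b` to `a` it is closedness under limits.
  refine hU.induction₂' (fun a b => (S a).IsVertexIndex I → (S b).IsVertexIndex I)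
    (fun a ha => ?_) (fun a b c _ _ _ hab hbc h => hbc (hab h)) hs ht h
  have hle : 𝓝[U] a ≤ 𝓝[Set.Icc 0 1] a := nhdsWithin_mono a hU1
  refine Eventually.and ?_ ?_
  · by_cases hV : (S a).IsVertexIndex I
    · filter_upwards [hle (hS.eventually_exists_of_isVertexIndex (hU1 ha) hV hI),
        self_mem_nhdsWithin] with b ⟨z, hz, hIz⟩ hb _
      exact (hsimple b hb).isVertexIndex (hS.presents b (hU1 hb)).isBounded hz hIz hI
    · exact Eventually.of_forall fun b hab => absurd hab hV
  · by_cases hV : (S a).IsVertexIndex I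
    · exact Eventually.of_forall fun b _ => hV
    · have hnot : ¬ ∃ᶠ b in 𝓝[Set.Icc 0 1] a, ∃ z ∈ (S b).polytope, I ⊆ (S b).tight z := by
        intro hf
        obtain ⟨z, hz, hIz⟩ := hS.exists_of_frequently (hU1 ha) hf
        exact hV ((hsimple a ha).isVertexIndex (hS.presents a (hU1 ha)).isBounded hz hIz hI)
      filter_upwards [hle (not_frequently.1 hnot)] with b hb hVb
      obtain ⟨z, hz, rfl⟩ := hVb
      exact absurd ⟨z, hz.1, subset_rfl⟩ hb

end IsFundamentalDeformation

/-! ### The passing time and the local picture at the passed vertex. -/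

/-- At the time `t₀` the moving hyperplane `π_i` passes through the vertex `u`. -/
structure IsPassing {d n : ℕ} (S : ℝ → HalfspaceSystem d n) (i : Fin n) (t₀ : ℝ)
    (u : EuclideanSpace ℝ (Fin d)) : Prop where
  deformation : IsFundamentalDeformation S i
  mem_Ioo : t₀ ∈ Set.Ioo (0 : ℝ) 1
  simple_iff : ∀ t ∈ Set.Icc (0 : ℝ) 1, (S t).IsSimple ↔ t ≠ t₀
  passed_iff : ∀ y, IsPassedVertex S i y ↔ y = u
  mem_hyperplane : u ∈ (S t₀).hyperplane i
  notMem : ∀ t ∈ Set.Ioc t₀ 1, u ∉ (S t).polytope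

theorem IsFundamentalDeformation.exists_isPassing {d n : ℕ} {S : ℝ → HalfspaceSystem d n}
    {i : Fin n} (hS : IsFundamentalDeformation S i) : ∃ t₀ u, IsPassing S i t₀ u := by
  obtain ⟨t₀, ht₀, h1, u, h2, h3, h4⟩ := hS.passes
  exact ⟨t₀, u, hS, ht₀, h1, h2, h3, h4⟩

namespace IsPassing

variable {d n : ℕ} {S : ℝ → HalfspaceSystem d n} {i : Fin n} {t₀ : ℝ}
  {u : EuclideanSpace ℝ (Fin d)} {I : Finset (Fin n)} {y : EuclideanSpace ℝ (Fin d)} {s t : ℝ}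

theorem _root_.zero_mem_Icc_zero_one : (0 : ℝ) ∈ Set.Icc (0 : ℝ) 1 := by simp

theorem _root_.one_mem_Icc_zero_one : (1 : ℝ) ∈ Set.Icc (0 : ℝ) 1 := by simp

theorem mem_Icc (hp : IsPassing S i t₀ u) : t₀ ∈ Set.Icc (0 : ℝ) 1 := Set.Ioo_subset_Icc_self hp.mem_Ioo

theorem isSimple (hp : IsPassing S i t₀ u) (ht : t ∈ Set.Icc (0 : ℝ) 1) (h : t ≠ t₀) :
    (S t).IsSimple := (hp.simple_iff t ht).2 h

theorem isSimple_zero (hp : IsPassing S i t₀ u) : (S 0).IsSimple :=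
  hp.isSimple zero_mem_Icc_zero_one hp.mem_Ioo.1.ne

theorem isSimple_one (hp : IsPassing S i t₀ u) : (S 1).IsSimple :=
  hp.isSimple one_mem_Icc_zero_one hp.mem_Ioo.2.ne'

theorem isBounded (hp : IsPassing S i t₀ u) (ht : t ∈ Set.Icc (0 : ℝ) 1) :
    Bornology.IsBounded (S t).polytope := (hp.deformation.presents t ht).isBounded

theorem isPassedVertex (hp : IsPassing S i t₀ u) : IsPassedVertex S i u := (hp.passed_iff u).2 rfl

theorem mem_extremePoints (hp : IsPassing S i t₀ u) : u ∈ (S 0).polytope.extremePoints ℝ :=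
  hp.isPassedVertex.1

theorem card_tight (hp : IsPassing S i t₀ u) : ((S 0).tight u).card = d :=
  isSimple_iff.1 hp.isSimple_zero u hp.mem_extremePoints

/-- The fixed hyperplanes that isolate `u` have spanning normals, so there are at least `d` of them;
with `π_i` this would exceed the `d` facets of a simple vertex. -/
theorem notMem_tight (hp : IsPassing S i t₀ u) : i ∉ (S 0).tight u := by
  intro hi
  obtain ⟨-, ⟨K, hiK, hK⟩, -⟩ := hp.isPassedVertex
  have huK : ∀ j ∈ K, inner ℝ ((S 0).normal j) u = (S 0).offset j := by
    have : u ∈ ⋂ j ∈ K, (S 0).hyperplane j := hK ▸ rfl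
    simpa [hyperplane] using this
  have hspan : (S 0).Spans K := by
    intro r hr
    have : u + r ∈ ⋂ j ∈ K, (S 0).hyperplane j := by
      simp only [Set.mem_iInter, hyperplane, Set.mem_ofPred_eq]
      intro j hj
      rw [inner_add_right, hr j hj, huK j hj, add_zero]
    rw [hK] at this
    simpa using this
  have h1 := hspan.le_card
  have h2 : insert i K ⊆ (S 0).tight u :=
    Finset.insert_subset hi fun j hj => mem_tight.2 (huK j hj)
  have h3 := Finset.card_le_card h2
  rw [Finset.card_insert_of_notMem hiK, hp.card_tight] at h3
  omega

theorem spans (hp : IsPassing S i t₀ u) (ht : t ∈ Set.Icc (0 : ℝ) 1) :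
    (S t).Spans ((S 0).tight u) :=
  hp.deformation.spans_of_notMem ht zero_mem_Icc_zero_one hp.notMem_tight
    (mem_extremePoints_iff_spans.1 hp.mem_extremePoints).2

theorem tight_subset (hp : IsPassing S i t₀ u) (ht : t ∈ Set.Icc (0 : ℝ) 1) :
    (S 0).tight u ⊆ (S t).tight u := fun _ hj =>
  (hp.deformation.mem_tight_iff ht zero_mem_Icc_zero_one
    (ne_of_mem_of_not_mem hj hp.notMem_tight)).2 hj

theorem inner_le_offset (hp : IsPassing S i t₀ u) (ht : t ∈ Set.Icc (0 : ℝ) 1) {j : Fin n}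
    (hj : j ≠ i) : inner ℝ ((S t).normal j) u ≤ (S t).offset j := by
  rw [hp.deformation.normal_fixed t ht j hj, hp.deformation.offset_fixed t ht j hj]
  exact hp.mem_extremePoints.1 j

theorem mem_polytope (hp : IsPassing S i t₀ u) (ht : t ∈ Set.Icc (0 : ℝ) 1) (htt : t ≤ t₀) :
    u ∈ (S t).polytope := by
  refine hp.deformation.subset_of_le ht hp.mem_Icc htt fun j => ?_
  by_cases hj : j = i
  · exact (hj ▸ hp.mem_hyperplane).le
  · exact hp.inner_le_offset hp.mem_Icc hj

theorem tight_passing (hp : IsPassing S i t₀ u) :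
    (S t₀).tight u = insert i ((S 0).tight u) := by
  ext j
  by_cases hj : j = i
  · subst hj
    have h : inner ℝ ((S t₀).normal j) u = (S t₀).offset j := hp.mem_hyperplane
    simpa using h
  · rw [hp.deformation.mem_tight_iff hp.mem_Icc zero_mem_Icc_zero_one hj, Finset.mem_insert]
    simp [hj]

/-- Touching `π_i(t)` before `t₀` would put `u` on `d + 1` facets of a simple polytope. -/
theorem inner_lt (hp : IsPassing S i t₀ u) (ht : t ∈ Set.Ico 0 t₀) :
    inner ℝ ((S t).normal i) u < (S t).offset i := by
  have ht1 : t ∈ Set.Icc (0 : ℝ) 1 := ⟨ht.1, ht.2.le.trans hp.mem_Icc.2⟩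
  have hu := hp.mem_polytope ht1 ht.2.le
  refine inner_lt_of_not_mem_tight hu fun hi => ?_
  have h1 := (hp.isSimple ht1 ht.2.ne).card_tight_le (hp.isBounded ht1) hu
  have h2 := Finset.card_le_card (Finset.insert_subset hi (hp.tight_subset ht1))
  rw [Finset.card_insert_of_notMem hp.notMem_tight, hp.card_tight] at h2
  omega

theorem lt_inner (hp : IsPassing S i t₀ u) (ht : t ∈ Set.Ioc t₀ 1) :
    (S t).offset i < inner ℝ ((S t).normal i) u := by
  by_contra! h
  refine hp.notMem t ht fun j => ?_
  by_cases hj : j = i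
  · exact hj ▸ h
  · exact hp.inner_le_offset ⟨hp.mem_Icc.1.trans ht.1.le, ht.2⟩ hj

/-- A nonempty interval of times next to, but not including, the passing time. -/
structure IsSide (t₀ : ℝ) (U : Set ℝ) : Prop where
  isPreconnected : IsPreconnected U
  subset : U ⊆ Set.Icc 0 1
  notMem : t₀ ∉ U
  neBot : (𝓝[U] t₀).NeBot

theorem isSide_Ico (hp : IsPassing S i t₀ u) : IsSide t₀ (Set.Ico 0 t₀) where
  isPreconnected := isPreconnected_Ico
  subset := fun _ ht => ⟨ht.1, ht.2.le.trans hp.mem_Icc.2⟩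
  notMem := fun h => h.2.false
  neBot := by rw [nhdsWithin_Ico_eq_nhdsLT hp.mem_Ioo.1]; infer_instance

theorem isSide_Ioc (hp : IsPassing S i t₀ u) : IsSide t₀ (Set.Ioc t₀ 1) where
  isPreconnected := isPreconnected_Ioc
  subset := fun _ ht => ⟨hp.mem_Icc.1.trans ht.1.le, ht.2⟩
  notMem := fun h => h.1.false
  neBot := by rw [nhdsWithin_Ioc_eq_nhdsGT hp.mem_Ioo.2]; infer_instance

theorem IsSide.exists {U : Set ℝ} (hU : IsSide t₀ U) {p : ℝ → Prop}
    (h : ∀ᶠ t in 𝓝[Set.Icc 0 1] t₀, p t) : ∃ t ∈ U, p t := by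
  have := hU.neBot
  exact (((h.filter_mono (nhdsWithin_mono _ hU.subset)).and self_mem_nhdsWithin).exists).imp
    fun _ h => ⟨h.2, h.1⟩

theorem isSimple_of_mem (hp : IsPassing S i t₀ u) {U : Set ℝ} (hU : IsSide t₀ U) (ht : t ∈ U) :
    (S t).IsSimple :=
  hp.isSimple (hU.subset ht) fun h => hU.notMem (h ▸ ht)

theorem isVertexIndex_iff (hp : IsPassing S i t₀ u) {U : Set ℝ} (hU : IsSide t₀ U) (hs : s ∈ U)
    (ht : t ∈ U) : (S s).IsVertexIndex I ↔ (S t).IsVertexIndex I :=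
  ⟨hp.deformation.isVertexIndex_of_isPreconnected hU.isPreconnected hU.subset
      (fun _ => hp.isSimple_of_mem hU) hs ht,
    hp.deformation.isVertexIndex_of_isPreconnected hU.isPreconnected hU.subset
      (fun _ => hp.isSimple_of_mem hU) ht hs⟩

/-- At the passing time, all other vertices are simple. -/
theorem card_tight_of_ne (hp : IsPassing S i t₀ u) (hy : y ∈ (S t₀).polytope.extremePoints ℝ)
    (hyu : y ≠ u) : ((S t₀).tight y).card = d := by
  have hspan := (mem_extremePoints_iff_spans.1 hy).2
  refine le_antisymm ?_ hspan.le_card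
  by_contra! hlt
  -- If `π_i` is transversal to the others or avoids `y`, an excess of facets persists to a time
  -- just before `t₀`, where `P(t)` is simple. Otherwise the fixed hyperplanes through `y` already
  -- determine it, so `y` is a passed vertex and must be `u`.
  by_cases h : i ∈ (S t₀).tight y → ∃ r,
      (∀ j ∈ (S t₀).tight y, j ≠ i → inner ℝ ((S t₀).normal j) r = 0) ∧
      inner ℝ ((S t₀).normal i) r ≠ 0
  · obtain ⟨t, ht, z, hz, hyz⟩ := hp.isSide_Ico.exists
      (hp.deformation.eventually_exists_tight hp.mem_Icc hy.1 h)
    have h1 := (hp.isSimple_of_mem hp.isSide_Ico ht).card_tight_le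
      (hp.isBounded (hp.isSide_Ico.subset ht)) hz
    have h2 := Finset.card_le_card hyz
    omega
  · push Not at h
    obtain ⟨hi, hr⟩ := h
    have hspan' : (S t₀).Spans (((S t₀).tight y).erase i) := by
      intro r hr0
      have h0 : ∀ j ∈ (S t₀).tight y, j ≠ i → inner ℝ ((S t₀).normal j) r = 0 :=
        fun j hj hji => hr0 j (Finset.mem_erase.2 ⟨hji, hj⟩)
      refine hspan r fun j hj => ?_
      by_cases hji : j = i
      · exact hji ▸ hr r h0
      · exact h0 j hj hji
    have hspan0 := hp.deformation.spans_of_notMem zero_mem_Icc_zero_one hp.mem_Icc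
      (Finset.notMem_erase i _) hspan'
    have hsub : ((S t₀).tight y).erase i ⊆ (S 0).tight y := fun j hj =>
      (hp.deformation.mem_tight_iff zero_mem_Icc_zero_one hp.mem_Icc (Finset.ne_of_mem_erase hj)).2
        (Finset.mem_of_mem_erase hj)
    have hy0 : y ∈ (S 0).polytope := hp.deformation.subset_of_le zero_mem_Icc_zero_one hp.mem_Icc
      hp.mem_Icc.1 hy.1
    refine hyu ((hp.passed_iff y).1 ⟨mem_extremePoints_of_spans hy0 hspan0 hsub,
      ⟨((S t₀).tight y).erase i, Finset.notMem_erase i _, ?_⟩, t₀, hp.mem_Icc, mem_tight.1 hi⟩)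
    ext z
    simp only [Set.mem_iInter, Set.mem_singleton_iff]
    constructor
    · intro hz
      exact eq_of_spans hspan0 (fun j hj => mem_tight.2 (hz j hj)) hsub
    · rintro rfl j hj
      exact mem_tight.1 (hsub hj)

/-- The limit of the vertices with index set `I` lies on the facets `I`, which excludes `u`; the
limit face therefore has a vertex on exactly `d` facets, namely `I`. -/
theorem isVertexIndex_passing (hp : IsPassing S i t₀ u) {U : Set ℝ} (hU : IsSide t₀ U) (hs : s ∈ U)
    (h : (S s).IsVertexIndex I) (hI : ¬ I ⊆ insert i ((S 0).tight u)) :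
    (S t₀).IsVertexIndex I := by
  have hc := h.card_eq (hp.isSimple_of_mem hU hs)
  have := hU.neBot
  have hf : ∃ᶠ t in 𝓝[Set.Icc 0 1] t₀, ∃ z ∈ (S t).polytope, I ⊆ (S t).tight z := by
    have h1 : ∀ᶠ t in 𝓝[U] t₀, ∃ z ∈ (S t).polytope, I ⊆ (S t).tight z := by
      filter_upwards [self_mem_nhdsWithin] with t ht
      obtain ⟨z, hz, rfl⟩ := (hp.isVertexIndex_iff hU hs ht).1 h
      exact ⟨z, hz.1, subset_rfl⟩
    exact h1.frequently.filter_mono (nhdsWithin_mono _ hU.subset)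
  obtain ⟨z, hz, hIz⟩ := hp.deformation.exists_of_frequently hp.mem_Icc hf
  obtain ⟨y, hy, hIy⟩ := exists_vertex_of_face_nonempty (hp.isBounded hp.mem_Icc) hz hIz
  refine ⟨y, hy, (Finset.eq_of_subset_of_card_le hIy ?_).symm⟩
  rw [hp.card_tight_of_ne hy (fun h => hI (by rw [← hp.tight_passing, ← h]; exact hIy)), hc]

theorem isVertexIndex_of_passing (hp : IsPassing S i t₀ u) {U : Set ℝ} (hU : IsSide t₀ U)
    (hs : s ∈ U) (h : (S t₀).IsVertexIndex I) (hI : I.card = d) : (S s).IsVertexIndex I := by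
  obtain ⟨t, ht, z, hz, hIz⟩ := hU.exists
    (hp.deformation.eventually_exists_of_isVertexIndex hp.mem_Icc h hI)
  exact (hp.isVertexIndex_iff hU ht hs).1 ((hp.isSimple_of_mem hU ht).isVertexIndex
    (hp.isBounded (hU.subset ht)) hz hIz hI)

theorem zero_mem_Ico (hp : IsPassing S i t₀ u) : (0 : ℝ) ∈ Set.Ico 0 t₀ := ⟨le_rfl, hp.mem_Ioo.1⟩

theorem one_mem_Ioc (hp : IsPassing S i t₀ u) : (1 : ℝ) ∈ Set.Ioc t₀ 1 := ⟨hp.mem_Ioo.2, le_rfl⟩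

/-- Away from the passed vertex, the vertices at the beginning and at the end correspond. -/
theorem isVertexIndex_zero_iff_one (hp : IsPassing S i t₀ u)
    (hI : ¬ I ⊆ insert i ((S 0).tight u)) : (S 0).IsVertexIndex I ↔ (S 1).IsVertexIndex I :=
  ⟨fun h => hp.isVertexIndex_of_passing hp.isSide_Ioc hp.one_mem_Ioc
      (hp.isVertexIndex_passing hp.isSide_Ico hp.zero_mem_Ico h hI) (h.card_eq hp.isSimple_zero),
    fun h => hp.isVertexIndex_of_passing hp.isSide_Ico hp.zero_mem_Ico
      (hp.isVertexIndex_passing hp.isSide_Ioc hp.one_mem_Ioc h hI) (h.card_eq hp.isSimple_one)⟩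

theorem not_isVertexIndex_one (hp : IsPassing S i t₀ u) :
    ¬ (S 1).IsVertexIndex ((S 0).tight u) := by
  rintro ⟨z, hz, hzu⟩
  have := eq_of_spans (hp.spans one_mem_Icc_zero_one) hzu.ge (hp.tight_subset one_mem_Icc_zero_one)
  exact hp.notMem 1 hp.one_mem_Ioc (this ▸ hz.1)

/-! ### Vertices next to the passed one on the moving hyperplane. -/

/-- The facets through the vertex next to `u` that misses the facet `j` and lies on `π_i`. -/
noncomputable def neighbor (S : ℝ → HalfspaceSystem d n) (i : Fin n) (u : EuclideanSpace ℝ (Fin d))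
    (j : Fin n) : Finset (Fin n) :=
  insert i (((S 0).tight u).erase j)

theorem card_neighbor (hp : IsPassing S i t₀ u) {j : Fin n} (hj : j ∈ (S 0).tight u) :
    (neighbor S i u j).card = d := by
  rw [neighbor, Finset.card_insert_of_notMem fun h => hp.notMem_tight (Finset.mem_of_mem_erase h),
    Finset.card_erase_of_mem hj, hp.card_tight]
  have := Finset.card_pos.2 ⟨j, hj⟩
  rw [hp.card_tight] at this
  omega

theorem eq_add_smul (hp : IsPassing S i t₀ u) (ht : t ∈ Set.Icc (0 : ℝ) 1) {j : Fin n}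
    {r : EuclideanSpace ℝ (Fin d)}
    (hr : ∀ m ∈ (S 0).tight u, inner ℝ ((S t).normal m) r = if m = j then -1 else 0)
    (hy : ((S 0).tight u).erase j ⊆ (S t).tight y) :
    y = u + ((S t).offset j - inner ℝ ((S t).normal j) y) • r := by
  rw [← sub_eq_zero]
  refine hp.spans ht _ fun m hm => ?_
  rw [inner_sub_right, inner_add_right, inner_smul_right, hr m hm,
    mem_tight.1 (hp.tight_subset ht hm)]
  by_cases hmj : m = j
  · subst hmj; simp
  · rw [mem_tight.1 (hy (Finset.mem_erase.2 ⟨hmj, hm⟩))]; simp [hmj]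

theorem exists_ray (hp : IsPassing S i t₀ u) (j : Fin n) : ∃ r, ∀ t ∈ Set.Icc (0 : ℝ) 1,
    ∀ m ∈ (S 0).tight u, inner ℝ ((S t).normal m) r = if m = j then -1 else 0 := by
  obtain ⟨r, hr⟩ := (hp.spans zero_mem_Icc_zero_one).exists_ray hp.card_tight j
  refine ⟨r, fun t ht m hm => ?_⟩
  rw [hp.deformation.normal_fixed t ht m (ne_of_mem_of_not_mem hm hp.notMem_tight)]
  exact hr m hm

/-- If the ray ran inside `π_i(t₀)`, the face of `P(t₀)` on `neighbor S i u j` would contain points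
other than `u`, hence a second vertex. That vertex would have exactly these `d` active normals, yet
all of them annihilate `r`. -/
theorem inner_ray_ne_zero (hp : IsPassing S i t₀ u) {j : Fin n} (hj : j ∈ (S 0).tight u)
    {r : EuclideanSpace ℝ (Fin d)}
    (hr : ∀ m ∈ (S 0).tight u, inner ℝ ((S t₀).normal m) r = if m = j then -1 else 0) :
    inner ℝ ((S t₀).normal i) r ≠ 0 := by
  intro h0
  have hu := hp.mem_polytope hp.mem_Icc le_rfl
  have hji : j ≠ i := ne_of_mem_of_not_mem hj hp.notMem_tight
  have hrj : inner ℝ ((S t₀).normal j) r = -1 := by simpa using hr j hj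
  have hr0 : r ≠ 0 := by rintro rfl; simp at hrj
  have hev : ∀ᶠ s in 𝓝[>] (0 : ℝ), ∀ m, inner ℝ ((S t₀).normal m) (u + s • r)
      ≤ (S t₀).offset m := by
    refine eventually_all.2 fun m => ?_
    by_cases hm : m ∈ (S t₀).tight u
    · filter_upwards [self_mem_nhdsWithin] with s hs
      have hs' : 0 < s := hs
      rw [inner_add_right, inner_smul_right, mem_tight.1 hm]
      rw [hp.tight_passing, Finset.mem_insert] at hm
      rcases hm with rfl | hm
      · rw [h0]; simp
      · rw [hr m hm]
        split_ifs
        · linarith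
        · simp
    · have hc : ContinuousAt (fun s : ℝ => inner ℝ ((S t₀).normal m) (u + s • r)) 0 := by fun_prop
      exact ((hc.eventually_lt continuousAt_const
        (by simpa using inner_lt_of_not_mem_tight hu hm)).mono fun s hs => hs.le).filter_mono
          nhdsWithin_le_nhds
  obtain ⟨s, hs, hs0⟩ := (hev.and self_mem_nhdsWithin).exists
  have hs0' : 0 < s := hs0
  have hann : ∀ m ∈ neighbor S i u j, inner ℝ ((S t₀).normal m) r = 0 := by
    intro m hm
    rcases Finset.mem_insert.1 hm with rfl | hm
    · exact h0
    · rw [hr m (Finset.mem_of_mem_erase hm), if_neg (Finset.ne_of_mem_erase hm)]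
  have hsub : neighbor S i u j ⊆ (S t₀).tight u := by
    rw [hp.tight_passing]
    exact Finset.insert_subset_insert i (Finset.erase_subset _ _)
  obtain ⟨x, hx, hIx, hxu⟩ := exists_vertex_ne (I := neighbor S i u j) (hp.isBounded hp.mem_Icc) u
    (z := u + s • r) hs (fun m hm => mem_tight.2 (by
      rw [inner_add_right, inner_smul_right, hann m hm, mem_tight.1 (hsub hm)]; simp))
    (by simp [hs0'.ne', hr0])
  have hxI : neighbor S i u j = (S t₀).tight x := Finset.eq_of_subset_of_card_le hIx (by
    rw [hp.card_tight_of_ne hx hxu, hp.card_neighbor hj])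
  exact hr0 ((mem_extremePoints_iff_spans.1 hx).2 r (hxI ▸ hann))

/-- The only candidate is `u + (κ / ρ) • r`, with `κ` the slack of `u` at `π_i(t)` and `ρ` the
pairing of `r` with its normal. Near `t₀` all remaining constraints hold strictly, so only the facet
`j` matters, and it requires `κ / ρ > 0`; the sign of `ρ` is that at `t₀`. -/
theorem eventually_isVertexIndex_neighbor_iff (hp : IsPassing S i t₀ u) {j : Fin n}
    (hj : j ∈ (S 0).tight u) {r : EuclideanSpace ℝ (Fin d)} (hr : ∀ t ∈ Set.Icc (0 : ℝ) 1,
      ∀ m ∈ (S 0).tight u, inner ℝ ((S t).normal m) r = if m = j then -1 else 0) :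
    ∀ᶠ t in 𝓝[Set.Icc 0 1] t₀, t ≠ t₀ → ((S t).IsVertexIndex (neighbor S i u j) ↔
      0 < ((S t).offset i - inner ℝ ((S t).normal i) u) * inner ℝ ((S t₀).normal i) r) := by
  have hu := hp.mem_polytope hp.mem_Icc le_rfl
  have hi : i ∈ (S t₀).tight u := by rw [hp.tight_passing]; exact Finset.mem_insert_self _ _
  filter_upwards [hp.deformation.eventually_shift hp.mem_Icc hu hi
    (hp.inner_ray_ne_zero hj (hr t₀ hp.mem_Icc)), self_mem_nhdsWithin] with t ⟨h1, h2⟩ ht htt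
  set ρ := inner ℝ ((S t).normal i) r with hρ
  set ρ₀ := inner ℝ ((S t₀).normal i) r
  set κ := (S t).offset i - inner ℝ ((S t).normal i) u with hκ
  have hρ0 : ρ ≠ 0 := left_ne_zero_of_mul h1.ne'
  have hκ0 : κ ≠ 0 := by
    rcases lt_or_gt_of_ne htt with h | h
    · exact (sub_pos.2 (hp.inner_lt ⟨ht.1, h⟩)).ne'
    · exact (sub_neg.2 (hp.lt_inner ⟨h, ht.2⟩)).ne
  have hsimple := hp.isSimple ht htt
  constructor
  · rintro ⟨z, hz, hzI⟩
    have hz1 := hp.eq_add_smul ht (hr t ht)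
      (y := z) (by rw [hzI]; exact Finset.subset_insert _ _)
    set σ := (S t).offset j - inner ℝ ((S t).normal j) z
    have hσ : 0 ≤ σ := sub_nonneg.2 (hz.1 j)
    have hzi : inner ℝ ((S t).normal i) z = (S t).offset i :=
      mem_tight.1 (hzI ▸ Finset.mem_insert_self _ _)
    rw [hz1, inner_add_right, inner_smul_right] at hzi
    have hκσ : κ = σ * ρ := by rw [hκ, hρ]; linarith
    have hσ0 : 0 < σ := lt_of_le_of_ne hσ fun h => hκ0 (by rw [hκσ, ← h, zero_mul])
    rw [hκσ, mul_assoc]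
    exact mul_pos hσ0 h1
  · intro hpos
    have hs : 0 < κ / ρ := by
      have : κ / ρ = (κ * ρ₀) * (ρ * ρ₀) / (ρ * ρ₀) ^ 2 := by
        have : ρ₀ ≠ 0 := right_ne_zero_of_mul h1.ne'
        field_simp
      rw [this]
      positivity
    have hval : ∀ m ∈ (S 0).tight u, inner ℝ ((S t).normal m) (u + (κ / ρ) • r)
        = (S t).offset m - if m = j then κ / ρ else 0 := by
      intro m hm
      rw [inner_add_right, inner_smul_right, hr t ht m hm, mem_tight.1 (hp.tight_subset ht hm)]
      split_ifs <;> ring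
    refine hsimple.isVertexIndex (hp.isBounded ht) (x := u + (κ / ρ) • r) (fun m => ?_)
      (fun m hm => mem_tight.2 ?_) (hp.card_neighbor hj)
    · by_cases hm : m ∈ (S t₀).tight u
      · rw [hp.tight_passing, Finset.mem_insert] at hm
        rcases hm with rfl | hm
        · exact (IsFundamentalDeformation.inner_shift hρ0).le
        · rw [hval m hm]
          split_ifs
          · linarith
          · simp
      · exact (h2 m hm).le
    · rcases Finset.mem_insert.1 hm with rfl | hm
      · exact IsFundamentalDeformation.inner_shift hρ0
      · rw [hval m (Finset.mem_of_mem_erase hm), if_neg (Finset.ne_of_mem_erase hm), sub_zero]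

/-- Each vertex next to the passed one on the moving hyperplane exists on exactly one side. -/
theorem isVertexIndex_neighbor_zero_iff (hp : IsPassing S i t₀ u) {j : Fin n}
    (hj : j ∈ (S 0).tight u) : (S 0).IsVertexIndex (neighbor S i u j) ↔
      ¬ (S 1).IsVertexIndex (neighbor S i u j) := by
  obtain ⟨r, hr⟩ := hp.exists_ray j
  have hev := hp.eventually_isVertexIndex_neighbor_iff hj hr
  have hne := hp.inner_ray_ne_zero hj (hr t₀ hp.mem_Icc)
  -- Index sets are constant on each side, so times close to `t₀` suffice; `κ` is positive at `s`
  -- and negative at `t`.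
  obtain ⟨s, hs, h1⟩ := hp.isSide_Ico.exists hev
  obtain ⟨t, ht, h2⟩ := hp.isSide_Ioc.exists hev
  rw [hp.isVertexIndex_iff hp.isSide_Ico hp.zero_mem_Ico hs, h1 hs.2.ne,
    hp.isVertexIndex_iff hp.isSide_Ioc hp.one_mem_Ioc ht, h2 ht.1.ne',
    mul_pos_iff_of_pos_left (sub_pos.2 (hp.inner_lt hs)), not_lt]
  have hneg : (S t).offset i - inner ℝ ((S t).normal i) u < 0 := sub_neg.2 (hp.lt_inner ht)
  constructor
  · exact fun h => (mul_neg_of_neg_of_pos hneg h).le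
  · exact fun h => lt_of_le_of_ne (nonneg_of_mul_nonpos_right h hneg) hne.symm

/-- The sets of `d` facets among those through `u` at the passing time. -/
theorem eq_or_exists_neighbor (hp : IsPassing S i t₀ u) (hI : I.card = d)
    (h : I ⊆ insert i ((S 0).tight u)) :
    I = (S 0).tight u ∨ ∃ j ∈ (S 0).tight u, I = neighbor S i u j := by
  by_cases hi : i ∈ I
  · right
    have hsub : I.erase i ⊆ (S 0).tight u := by
      intro m hm
      rcases Finset.mem_insert.1 (h (Finset.mem_of_mem_erase hm)) with h | h
      · exact absurd h (Finset.ne_of_mem_erase hm)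
      · exact h
    have hcard : (I.erase i).card + 1 = d := by rw [Finset.card_erase_add_one hi, hI]
    obtain ⟨j, hj, hjI⟩ := Finset.exists_of_ssubset (Finset.ssubset_iff_subset_ne.2 ⟨hsub, fun h => by
      rw [h, hp.card_tight] at hcard; omega⟩)
    refine ⟨j, hj, Finset.eq_of_subset_of_card_le (fun m hm => ?_) ?_⟩
    · by_cases hmi : m = i
      · exact hmi ▸ Finset.mem_insert_self _ _
      · have hm' : m ∈ I.erase i := Finset.mem_erase.2 ⟨hmi, hm⟩
        exact Finset.mem_insert_of_mem (Finset.mem_erase.2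
          ⟨ne_of_mem_of_not_mem hm' hjI, hsub hm'⟩)
    · rw [hp.card_neighbor hj, hI]
  · left
    refine Finset.eq_of_subset_of_card_le (fun m hm => ?_) (by rw [hp.card_tight, hI])
    exact (Finset.mem_insert.1 (h hm)).resolve_left (ne_of_mem_of_not_mem hm hi)

end IsPassing

/-! ### Identifying the vanishing edge. -/

theorem isVanishingEdge_segment_iff {d n : ℕ} {S : ℝ → HalfspaceSystem d n}
    {a b : EuclideanSpace ℝ (Fin d)} (ha : a ∈ (S 0).polytope) (hb : b ∈ (S 0).polytope) :
    IsVanishingEdge S (segment ℝ a b) ↔ IsPolytopeEdge (S 0).polytope (segment ℝ a b) ∧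
      ∀ z ∈ (S 1).polytope, ¬ (S 0).tight a ∩ (S 0).tight b ⊆ (S 1).tight z := by
  rw [IsVanishingEdge, Set.eq_empty_iff_forall_notMem]
  refine and_congr_right fun _ => forall_congr' fun z => ?_
  simp only [segment_subset_facet_iff ha hb, Set.mem_ofPred_eq, not_and]
  refine forall_congr' fun hz => not_congr ?_
  simp only [mem_facet_iff hz]
  rfl

namespace IsPassing

variable {d n : ℕ} {S : ℝ → HalfspaceSystem d n} {i : Fin n} {t₀ : ℝ}
  {u : EuclideanSpace ℝ (Fin d)} {I : Finset (Fin n)} {x y : EuclideanSpace ℝ (Fin d)}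

theorem erase_subset_neighbor (j : Fin n) : ((S 0).tight u).erase j ⊆ neighbor S i u j :=
  Finset.subset_insert _ _

theorem neighbor_subset (j : Fin n) : neighbor S i u j ⊆ insert i ((S 0).tight u) :=
  Finset.insert_subset_insert _ (Finset.erase_subset _ _)

theorem notMem_neighbor (hp : IsPassing S i t₀ u) {j : Fin n} (hj : j ∈ (S 0).tight u) :
    j ∉ neighbor S i u j := fun h => by
  rcases Finset.mem_insert.1 h with rfl | h
  · exact hp.notMem_tight hj
  · exact Finset.notMem_erase _ _ h

theorem card_erase (hp : IsPassing S i t₀ u) {j : Fin n} (hj : j ∈ (S 0).tight u) :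
    (((S 0).tight u).erase j).card + 1 = d := by
  rw [Finset.card_erase_add_one hj, hp.card_tight]

theorem ne_of_tight_eq_neighbor (hp : IsPassing S i t₀ u) {j : Fin n}
    (hxj : (S 0).tight x = neighbor S i u j) : x ≠ u := by
  rintro rfl
  exact hp.notMem_tight (hxj ▸ Finset.mem_insert_self _ _)

/-- An edge from the passed vertex to a vertex on the moving hyperplane is vanishing. -/
theorem isVanishingEdge (hp : IsPassing S i t₀ u) {j : Fin n} (hj : j ∈ (S 0).tight u)
    (hx : x ∈ (S 0).polytope.extremePoints ℝ) (hxj : (S 0).tight x = neighbor S i u j) :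
    IsVanishingEdge S (segment ℝ u x) := by
  have hu := hp.mem_extremePoints
  have hux := (hp.ne_of_tight_eq_neighbor hxj).symm
  have hKx : ((S 0).tight u).erase j ⊆ (S 0).tight x := hxj ▸ erase_subset_neighbor j
  have hKI := Finset.subset_inter (Finset.erase_subset j ((S 0).tight u)) hKx
  have hcard := hp.card_erase hj
  rw [isVanishingEdge_segment_iff hu.1 hx.1]
  refine ⟨(isPolytopeEdge_segment_iff hp.isSimple_zero hu hx hux).2 ?_, fun z hz hIz => ?_⟩
  · have := Finset.card_le_card hKI
    omega
  · obtain ⟨y, hy, hKy⟩ := exists_vertex_of_face_nonempty (hp.isBounded one_mem_Icc_zero_one) hz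
      (hKI.trans hIz)
    have hyV : (S 1).IsVertexIndex ((S 1).tight y) := ⟨y, hy, rfl⟩
    by_cases hyI : (S 1).tight y ⊆ insert i ((S 0).tight u)
    · rcases hp.eq_or_exists_neighbor (hyV.card_eq hp.isSimple_one) hyI with h | ⟨m, hm, h⟩
      · exact hp.not_isVertexIndex_one (h ▸ hyV)
      · by_cases hmj : m = j
        · subst hmj
          exact (hp.isVertexIndex_neighbor_zero_iff hj).1 ⟨x, hx, hxj⟩ (h ▸ hyV)
        · exact hp.notMem_neighbor hm (h ▸ hKy (Finset.mem_erase.2 ⟨hmj, hm⟩))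
    · obtain ⟨y₀, hy₀, hyy⟩ := (hp.isVertexIndex_zero_iff_one hyI).2 hyV
      have hmem : y₀ ∈ (S 0).face (((S 0).tight u).erase j) := ⟨hy₀.1, hyy ▸ hKy⟩
      rw [face_eq_segment hp.isSimple_zero hu hx hux (Finset.erase_subset _ _) hKx hcard.ge] at hmem
      rw [← hyy] at hyI
      rcases eq_or_eq_of_mem_segment hy₀ hu.1 hx.1 hmem with rfl | rfl
      · exact hyI (Finset.subset_insert _ _)
      · exact hyI (hxj ▸ neighbor_subset j)

end IsPassing

/-- The vertex `u` is passed, `u` and `x` are the ends of the vanishing edge, and `k` is the facet at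
`u` that does not contain `x`. -/
structure IsFlip {d n : ℕ} (S : ℝ → HalfspaceSystem d n) (i : Fin n) (t₀ : ℝ)
    (u x : EuclideanSpace ℝ (Fin d)) (k : Fin n) : Prop extends IsPassing S i t₀ u where
  mem_tight : k ∈ (S 0).tight u
  mem_extremePoints_other : x ∈ (S 0).polytope.extremePoints ℝ
  tight_other : (S 0).tight x = IsPassing.neighbor S i u k
  isVertexIndex_zero_iff : ∀ j ∈ (S 0).tight u,
    ((S 0).IsVertexIndex (IsPassing.neighbor S i u j) ↔ j = k)

theorem IsPassing.exists_isFlip {d n : ℕ} {S : ℝ → HalfspaceSystem d n} {i : Fin n} {t₀ : ℝ}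
    {u v w : EuclideanSpace ℝ (Fin d)} (hp : IsPassing S i t₀ u)
    (hvw : IsVanishingEdge S (segment ℝ v w)) :
    ∃ x k, IsFlip S i t₀ u x k ∧ ((v = u ∧ w = x) ∨ (v = x ∧ w = u)) := by
  obtain ⟨hv, hw, hne⟩ := hvw.1.ends
  have hvan := ((isVanishingEdge_segment_iff hv.1 hw.1).1 hvw).2
  have huniq : ∀ e, IsVanishingEdge S e → e = segment ℝ v w := fun e he =>
    hp.deformation.existsUnique_vanishing.unique he hvw
  -- An end with any other index set would persist to `P(1)` and lie on all facets of the edge.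
  have hend : ∀ y ∈ (S 0).polytope.extremePoints ℝ,
      (S 0).tight v ∩ (S 0).tight w ⊆ (S 0).tight y →
      y = u ∨ ∃ j ∈ (S 0).tight u, (S 0).tight y = neighbor S i u j := by
    intro y hy hsub
    have hyV : (S 0).IsVertexIndex ((S 0).tight y) := ⟨y, hy, rfl⟩
    by_cases hyI : (S 0).tight y ⊆ insert i ((S 0).tight u)
    · rcases hp.eq_or_exists_neighbor (hyV.card_eq hp.isSimple_zero) hyI with h | h
      · exact Or.inl (eq_of_tight_subset hy h.le)
      · exact Or.inr h
    · obtain ⟨z, hz, hzy⟩ := (hp.isVertexIndex_zero_iff_one hyI).1 hyV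
      exact absurd (hzy ▸ hsub) (hvan z hz.1)
  obtain ⟨x, hx, k, hk, hxk⟩ : ∃ x ∈ (S 0).polytope.extremePoints ℝ, ∃ k ∈ (S 0).tight u,
      (S 0).tight x = neighbor S i u k := by
    rcases hend v hv Finset.inter_subset_left with h1 | ⟨j, hj, h⟩
    · rcases hend w hw Finset.inter_subset_right with h2 | ⟨j, hj, h⟩
      · exact absurd (h1.trans h2.symm) hne
      · exact ⟨w, hw, j, hj, h⟩
    · exact ⟨v, hv, j, hj, h⟩
  have hseg := huniq _ (hp.isVanishingEdge hk hx hxk)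
  refine ⟨x, k, ⟨hp, hk, hx, hxk, fun j hj => ⟨?_, ?_⟩⟩, ?_⟩
  -- A second neighbor in `P(0)` would span another vanishing edge with `u`.
  · rintro ⟨y, hy, hyj⟩
    have hyx := (huniq _ (hp.isVanishingEdge hj hy hyj)).trans hseg.symm
    have h := segment_eq_segment_of_mem_extremePoints hp.mem_extremePoints hx
      (hp.ne_of_tight_eq_neighbor hxk).symm hp.mem_extremePoints.1 hy.1 hyx
    rcases h with ⟨-, rfl⟩ | ⟨h, -⟩
    · by_contra hjk
      refine hp.notMem_neighbor hj ?_
      rw [← hyj, hxk]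
      exact erase_subset_neighbor k (Finset.mem_erase.2 ⟨hjk, hj⟩)
    · exact absurd h.symm (hp.ne_of_tight_eq_neighbor hxk)
  · rintro rfl
    exact ⟨x, hx, hxk⟩
  · exact segment_eq_segment_of_mem_extremePoints hp.mem_extremePoints hx
      (hp.ne_of_tight_eq_neighbor hxk).symm hv.1 hw.1 hseg.symm

/-! ### The new face is a simplex. -/

namespace IsFlip

open IsPassing

variable {d n : ℕ} {S : ℝ → HalfspaceSystem d n} {i k : Fin n} {t₀ : ℝ}
  {u x v w y z : EuclideanSpace ℝ (Fin d)}

theorem ne (hf : IsFlip S i t₀ u x k) : k ≠ i :=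
  ne_of_mem_of_not_mem hf.mem_tight hf.notMem_tight

theorem xor_iff (hf : IsFlip S i t₀ u x k) (j : Fin n) :
    Xor (u ∈ (S 0).facet j) (x ∈ (S 0).facet j) ↔ j = i ∨ j = k := by
  rw [mem_facet_iff hf.mem_extremePoints.1, mem_facet_iff hf.mem_extremePoints_other.1,
    hf.tight_other, neighbor, Finset.mem_insert, Finset.mem_erase]
  have h1 := hf.notMem_tight
  have h2 := hf.mem_tight
  by_cases hji : j = i
  · subst hji
    simp [h1, Xor]
  · by_cases hjk : j = k
    · subst hjk
      simp [h2, Xor, hji]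
    · simp [hji, hjk, Xor]

theorem isVertexIndex_one_iff (hf : IsFlip S i t₀ u x k) {j : Fin n} (hj : j ∈ (S 0).tight u) :
    (S 1).IsVertexIndex (neighbor S i u j) ↔ j ≠ k := by
  rw [ne_eq, ← hf.isVertexIndex_zero_iff j hj, hf.isVertexIndex_neighbor_zero_iff hj, not_not]

/-- A vertex off the vanishing edge has a corresponding vertex at the end. -/
theorem isVertexIndex_one (hf : IsFlip S i t₀ u x k) (hy : y ∈ (S 0).polytope.extremePoints ℝ)
    (hyu : y ≠ u) (hyx : y ≠ x) : (S 1).IsVertexIndex ((S 0).tight y) := by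
  have hyV : (S 0).IsVertexIndex ((S 0).tight y) := ⟨y, hy, rfl⟩
  by_cases hyI : (S 0).tight y ⊆ insert i ((S 0).tight u)
  · rcases hf.eq_or_exists_neighbor (hyV.card_eq hf.isSimple_zero) hyI with h | ⟨j, hj, h⟩
    · exact absurd (eq_of_tight_subset hy h.le) hyu
    · obtain rfl := (hf.isVertexIndex_zero_iff j hj).1 (h ▸ hyV)
      exact absurd (eq_of_tight_subset hy (h.trans hf.tight_other.symm).le) hyx
  · exact (hf.isVertexIndex_zero_iff_one hyI).1 hyV

theorem newFace_eq (hf : IsFlip S i t₀ u x k) (hvw : (v = u ∧ w = x) ∨ (v = x ∧ w = u)) :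
    newFace S v w = (S 1).facet i ∩ (S 1).facet k := by
  have h : ∀ j, Xor (v ∈ (S 0).facet j) (w ∈ (S 0).facet j) ↔ j = i ∨ j = k := by
    intro j
    rcases hvw with ⟨rfl, rfl⟩ | ⟨rfl, rfl⟩
    · exact hf.xor_iff j
    · rw [xor_comm]; exact hf.xor_iff j
  ext z
  simp only [newFace, h, Set.mem_ofPred_eq, forall_eq_or_imp, forall_eq]
  exact ⟨fun h => h.2, fun h => ⟨h.1.1, h⟩⟩

/-- The vertices of the new face. -/
theorem exists_newVertex (hf : IsFlip S i t₀ u x k) :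
    ∃ q : Fin n → EuclideanSpace ℝ (Fin d), ∀ m ∈ ((S 0).tight u).erase k,
      q m ∈ (S 1).polytope.extremePoints ℝ ∧ (S 1).tight (q m) = neighbor S i u m := by
  have h : ∀ m, ∃ p, m ∈ ((S 0).tight u).erase k →
      p ∈ (S 1).polytope.extremePoints ℝ ∧ (S 1).tight p = neighbor S i u m := by
    intro m
    by_cases hm : m ∈ ((S 0).tight u).erase k
    · obtain ⟨p, hp⟩ := (hf.isVertexIndex_one_iff (Finset.mem_of_mem_erase hm)).2
        (Finset.ne_of_mem_erase hm)
      exact ⟨p, fun _ => hp⟩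
    · exact ⟨0, fun h => absurd h hm⟩
  choose q hq using h
  exact ⟨q, fun m => hq m⟩

section Simplex

variable {q : Fin n → EuclideanSpace ℝ (Fin d)}

theorem newVertex_mem (hf : IsFlip S i t₀ u x k) {m : Fin n} (hm : m ∈ ((S 0).tight u).erase k)
    (hq : q m ∈ (S 1).polytope.extremePoints ℝ ∧ (S 1).tight (q m) = neighbor S i u m) :
    q m ∈ (S 1).facet i ∩ (S 1).facet k := by
  rw [Set.mem_inter_iff, mem_facet_iff hq.1.1, mem_facet_iff hq.1.1, hq.2]
  exact ⟨Finset.mem_insert_self _ _, Finset.mem_insert_of_mem (Finset.mem_erase.2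
    ⟨(Finset.ne_of_mem_erase hm).symm, hf.mem_tight⟩)⟩

theorem newVertex_gap_pos (hf : IsFlip S i t₀ u x k) {m : Fin n}
    (hm : m ∈ ((S 0).tight u).erase k)
    (hq : q m ∈ (S 1).polytope.extremePoints ℝ ∧ (S 1).tight (q m) = neighbor S i u m) :
    0 < (S 1).offset m - inner ℝ ((S 1).normal m) (q m) := by
  refine sub_pos.2 (inner_lt_of_not_mem_tight hq.1.1 ?_)
  rw [hq.2]
  exact hf.notMem_neighbor (Finset.mem_of_mem_erase hm)

/-- The slack at the facet `a` is an affine function vanishing at every new vertex except `q a`, so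
it isolates the coefficient of `q a`. -/
theorem affineIndependent_newVertex (hf : IsFlip S i t₀ u x k)
    (hq : ∀ m ∈ ((S 0).tight u).erase k,
      q m ∈ (S 1).polytope.extremePoints ℝ ∧ (S 1).tight (q m) = neighbor S i u m) :
    AffineIndependent ℝ fun m : ((S 0).tight u).erase k => q m := by
  rw [affineIndependent_iff]
  intro s f hf0 hf1 a ha
  have hgap := hf.newVertex_gap_pos a.2 (hq a a.2)
  have h1 : ∑ e ∈ s, f e * (inner ℝ ((S 1).normal a) (q e) - (S 1).offset a) = 0 := by
    have := congrArg (fun p => inner ℝ ((S 1).normal a) p) hf1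
    simp only [inner_sum, inner_smul_right, inner_zero_right] at this
    simp only [mul_sub, Finset.sum_sub_distrib, this, ← Finset.sum_mul, hf0]
    simp
  rw [Finset.sum_eq_single a] at h1
  · rcases mul_eq_zero.1 h1 with h | h
    · exact h
    · linarith
  · intro b hb hba
    have : (a : Fin n) ∈ (S 1).tight (q b) := by
      rw [(hq b b.2).2]
      exact erase_subset_neighbor _ (Finset.mem_erase.2
        ⟨fun h => hba (Subtype.ext h.symm), Finset.mem_of_mem_erase a.2⟩)
    rw [HalfspaceSystem.mem_tight.1 this, sub_self, mul_zero]
  · exact fun h => absurd ha h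

/-- Near `u` the fixed facets form a simplicial cone; a point of `F_k` is `u` plus its slacks times
the rays `r m`, `m ≠ k`, and `π_i(1)` cuts these rays at the new vertices. -/
theorem newFace_eq_convexHull (hf : IsFlip S i t₀ u x k)
    (hq : ∀ m ∈ ((S 0).tight u).erase k,
      q m ∈ (S 1).polytope.extremePoints ℝ ∧ (S 1).tight (q m) = neighbor S i u m) :
    (S 1).facet i ∩ (S 1).facet k = convexHull ℝ (q '' (((S 0).tight u).erase k : Finset (Fin n))) := by
  have h1 := one_mem_Icc_zero_one
  apply Set.Subset.antisymm
  · rintro y ⟨⟨hy, hyi⟩, -, hyk⟩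
    choose r hr using hf.exists_ray
    set κ := inner ℝ ((S 1).normal i) u - (S 1).offset i with hκ
    have hκ0 : 0 < κ := sub_pos.2 (hf.lt_inner hf.one_mem_Ioc)
    -- All new vertices are on `π_i(1)`, which `u` oversteps by `κ`; this common value makes the
    -- coefficients below sum to one.
    have hqi : ∀ m ∈ ((S 0).tight u).erase k,
        ((S 1).offset m - inner ℝ ((S 1).normal m) (q m)) * inner ℝ ((S 1).normal i) (r m)
          = -κ := by
      intro m hm
      have h := hf.eq_add_smul h1 (hr m 1 h1) (y := q m)
        ((hq m hm).2 ▸ erase_subset_neighbor m)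
      have hi : i ∈ (S 1).tight (q m) := (hq m hm).2 ▸ Finset.mem_insert_self _ _
      have h2 := HalfspaceSystem.mem_tight.1 hi
      rw [h, inner_add_right, inner_smul_right] at h2
      linarith
    have hyu : y = u + ∑ m ∈ ((S 0).tight u).erase k,
        ((S 1).offset m - inner ℝ ((S 1).normal m) y) • r m := by
      rw [← sub_eq_zero]
      refine hf.spans h1 _ fun j hj => ?_
      rw [inner_sub_right, inner_add_right, inner_sum,
        HalfspaceSystem.mem_tight.1 (hf.tight_subset h1 hj)]
      simp only [inner_smul_right]
      rw [Finset.sum_congr rfl fun m _ => by rw [hr m 1 h1 j hj]]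
      simp only [mul_ite, mul_neg, mul_one, mul_zero, Finset.sum_ite_eq]
      split_ifs with h
      · ring
      · have : j = k := by
          by_contra hjk
          exact h (Finset.mem_erase.2 ⟨hjk, hj⟩)
        subst this
        have : inner ℝ ((S 1).normal j) y = (S 1).offset j := hyk
        rw [this]; ring
    -- The barycentric coordinates: `q m` is the only new vertex off the facet `m`, so its weight is
    -- a ratio of slacks there.
    set c : Fin n → ℝ := fun m => ((S 1).offset m - inner ℝ ((S 1).normal m) y) /
      ((S 1).offset m - inner ℝ ((S 1).normal m) (q m)) with hc
    have hc0 : ∀ m ∈ ((S 0).tight u).erase k, 0 ≤ c m := fun m hm =>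
      div_nonneg (sub_nonneg.2 (hy m)) (hf.newVertex_gap_pos hm (hq m hm)).le
    have hcg : ∀ m ∈ ((S 0).tight u).erase k,
        c m * ((S 1).offset m - inner ℝ ((S 1).normal m) (q m))
          = (S 1).offset m - inner ℝ ((S 1).normal m) y := fun m hm =>
      div_mul_cancel₀ _ (hf.newVertex_gap_pos hm (hq m hm)).ne'
    have hc1 : ∑ m ∈ ((S 0).tight u).erase k, c m = 1 := by
      have h2 : inner ℝ ((S 1).normal i) y = (S 1).offset i := hyi
      rw [hyu, inner_add_right, inner_sum] at h2
      simp only [inner_smul_right] at h2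
      have h3 : ∑ m ∈ ((S 0).tight u).erase k, ((S 1).offset m - inner ℝ ((S 1).normal m) y) *
          inner ℝ ((S 1).normal i) (r m) = (∑ m ∈ ((S 0).tight u).erase k, c m) * -κ := by
        rw [Finset.sum_mul]
        refine Finset.sum_congr rfl fun m hm => ?_
        rw [← hcg m hm, mul_assoc, hqi m hm]
      rw [h3] at h2
      have h4 : (∑ m ∈ ((S 0).tight u).erase k, c m) * κ = 1 * κ := by linarith
      exact mul_right_cancel₀ hκ0.ne' h4
    have hyq : y = ∑ m ∈ ((S 0).tight u).erase k, c m • q m := by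
      have h2 : ∑ m ∈ ((S 0).tight u).erase k, c m • q m
          = ∑ m ∈ ((S 0).tight u).erase k, (c m • u +
            ((S 1).offset m - inner ℝ ((S 1).normal m) y) • r m) := by
        refine Finset.sum_congr rfl fun m hm => ?_
        have h := hf.eq_add_smul h1 (hr m 1 h1) (y := q m)
          ((hq m hm).2 ▸ erase_subset_neighbor m)
        rw [← hcg m hm, mul_smul, ← smul_add, ← h]
      rw [h2, Finset.sum_add_distrib, ← Finset.sum_smul, hc1, one_smul, ← hyu]
    rw [hyq]
    exact (convex_convexHull ℝ _).sum_mem hc0 hc1 fun m hm =>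
      subset_convexHull ℝ _ (Set.mem_image_of_mem q hm)
  · have hconv : ∀ j, Convex ℝ ((S 1).facet j) := fun j => by
      have : (S 1).facet j = (S 1).face {j} := by
        ext z
        exact and_congr_right fun _ => by
          rw [Finset.singleton_subset_iff, HalfspaceSystem.mem_tight]; rfl
      rw [this]
      exact ((S 1).isExposed_face {j}).convex (S 1).convex_polytope
    refine convexHull_min ?_ ((hconv i).inter (hconv k))
    rintro _ ⟨m, hm, rfl⟩
    exact hf.newVertex_mem hm (hq m hm)

theorem exists_eq_newVertex (hf : IsFlip S i t₀ u x k)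
    (hq : ∀ m ∈ ((S 0).tight u).erase k,
      q m ∈ (S 1).polytope.extremePoints ℝ ∧ (S 1).tight (q m) = neighbor S i u m)
    (hy : y ∈ (S 1).polytope.extremePoints ℝ) (hyN : y ∈ (S 1).facet i ∩ (S 1).facet k) :
    ∃ m ∈ ((S 0).tight u).erase k, y = q m := by
  have hsub : (S 1).facet i ∩ (S 1).facet k ⊆ (S 1).polytope := fun z hz => hz.1.1
  have h := inter_extremePoints_subset_extremePoints_of_subset hsub ⟨hyN, hy⟩
  rw [hf.newFace_eq_convexHull hq] at h
  obtain ⟨m, hm, rfl⟩ := extremePoints_convexHull_subset h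
  exact ⟨m, hm, rfl⟩

theorem tight_of_mem_newFace (hf : IsFlip S i t₀ u x k)
    (hy : y ∈ (S 1).polytope.extremePoints ℝ) (hyN : y ∈ (S 1).facet i ∩ (S 1).facet k) :
    ∃ m ∈ ((S 0).tight u).erase k, (S 1).tight y = neighbor S i u m := by
  obtain ⟨q, hq⟩ := hf.exists_newVertex
  obtain ⟨m, hm, rfl⟩ := hf.exists_eq_newVertex hq hy hyN
  exact ⟨m, hm, (hq m hm).2⟩

theorem exists_simplex (hf : IsFlip S i t₀ u x k) : ∃ q : Fin (d - 1) → EuclideanSpace ℝ (Fin d),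
    AffineIndependent ℝ q ∧ (S 1).facet i ∩ (S 1).facet k = convexHull ℝ (Set.range q) := by
  obtain ⟨q, hq⟩ := hf.exists_newVertex
  have hcard : (((S 0).tight u).erase k).card = d - 1 := by
    have := hf.card_erase hf.mem_tight; omega
  obtain ⟨e⟩ : Nonempty (Fin (d - 1) ≃ ((S 0).tight u).erase k) :=
    ⟨((((S 0).tight u).erase k).equivFinOfCardEq hcard).symm⟩
  refine ⟨fun a => q (e a),
    (hf.affineIndependent_newVertex hq).comp_embedding e.toEmbedding, ?_⟩
  have hrange : q '' (((S 0).tight u).erase k : Finset (Fin n)) = Set.range fun a => q (e a) := by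
    ext z
    constructor
    · rintro ⟨m, hm, rfl⟩
      exact ⟨e.symm ⟨m, hm⟩, by simp⟩
    · rintro ⟨a, rfl⟩
      exact ⟨e a, (e a).2, rfl⟩
  rw [hf.newFace_eq_convexHull hq, hrange]

/-- Each new index set omits one of the same `d + 1` indices, so two of them share `d - 1`. -/
theorem isPolytopeEdge_of_mem_newFace (hf : IsFlip S i t₀ u x k)
    (hy : y ∈ (S 1).polytope.extremePoints ℝ) (hz : z ∈ (S 1).polytope.extremePoints ℝ)
    (hyN : y ∈ (S 1).facet i ∩ (S 1).facet k) (hzN : z ∈ (S 1).facet i ∩ (S 1).facet k)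
    (hyz : y ≠ z) : IsPolytopeEdge (S 1).polytope (segment ℝ y z) := by
  obtain ⟨a, ha, hya⟩ := hf.tight_of_mem_newFace hy hyN
  obtain ⟨b, hb, hzb⟩ := hf.tight_of_mem_newFace hz hzN
  rw [isPolytopeEdge_segment_iff hf.isSimple_one hy hz hyz, hya, hzb]
  have hsub : (neighbor S i u a).erase b ⊆ neighbor S i u a ∩ neighbor S i u b := by
    intro m hm
    obtain ⟨hmb, hma⟩ := Finset.mem_erase.1 hm
    refine Finset.mem_inter.2 ⟨hma, ?_⟩
    rcases Finset.mem_insert.1 hma with rfl | h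
    · exact Finset.mem_insert_self _ _
    · exact Finset.mem_insert_of_mem (Finset.mem_erase.2 ⟨hmb, Finset.mem_of_mem_erase h⟩)
  have h1 := Finset.card_le_card hsub
  have h2 := Finset.pred_card_le_card_erase (s := neighbor S i u a) (a := b)
  rw [hf.card_neighbor (Finset.mem_of_mem_erase ha)] at h2
  omega

end Simplex

end IsFlip

/-! ### Edge-following paths and walks in the edge graph. -/

section EdgePaths

variable {d : ℕ} {P : Set (EuclideanSpace ℝ (Fin d))} {l : ℕ} {p : ℝ → EuclideanSpace ℝ (Fin d)}

theorem IsEdgeFollowingPath.mem_extremePoints (hp : IsEdgeFollowingPath P l p) {m : ℕ} (hm : m ≤ l) :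
    p m ∈ P.extremePoints ℝ :=
  (hp.vertex_iff m ⟨m.cast_nonneg, Nat.cast_le.2 hm⟩).2 ⟨m, rfl⟩

/-- The ends of the edge `p([m, m + 1])` are vertices, hence values at integer times, and only `m`
and `m + 1` are available. -/
theorem IsEdgeFollowingPath.isPolytopeEdge (hp : IsEdgeFollowingPath P l p) {m : ℕ} (hm : m < l) :
    IsPolytopeEdge P (segment ℝ (p m) (p (m + 1 : ℕ))) := by
  have hedge := hp.edge m hm
  obtain ⟨-, a, ha, b, hb, hab, hseg⟩ := hp.edge m hm
  have hend : ∀ c ∈ P.extremePoints ℝ, c ∈ p '' Set.Icc (m : ℝ) (m + 1) →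
      c = p m ∨ c = p (m + 1 : ℕ) := by
    rintro _ hc ⟨s, hs, rfl⟩
    have hml : ((m + 1 : ℕ) : ℝ) ≤ l := Nat.cast_le.2 hm
    push_cast at hml
    obtain ⟨e, rfl⟩ := (hp.vertex_iff s ⟨m.cast_nonneg.trans hs.1, hs.2.trans hml⟩).1 hc
    have h1 : m ≤ e := by exact_mod_cast hs.1
    have h2 : e ≤ m + 1 := by exact_mod_cast hs.2
    rcases h1.eq_or_lt with rfl | h
    · exact Or.inl rfl
    · obtain rfl : e = m + 1 := by omega
      exact Or.inr rfl
  have h1 := hend a ha (hseg ▸ left_mem_segment ℝ a b)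
  have h2 := hend b hb (hseg ▸ right_mem_segment ℝ a b)
  rw [hseg] at hedge
  rcases h1 with h1 | h1 <;> rcases h2 with h2 | h2
  · exact absurd (h1.trans h2.symm) hab
  · rwa [← h1, ← h2]
  · rwa [segment_symm, ← h1, ← h2]
  · exact absurd (h1.trans h2.symm) hab

theorem IsEdgeFollowingPath.passesThrough_iff (hp : IsEdgeFollowingPath P l p)
    {v : EuclideanSpace ℝ (Fin d)} (hv : v ∈ P.extremePoints ℝ) :
    PassesThrough l p v ↔ ∃ m ≤ l, p (m : ℕ) = v := by
  constructor
  · rintro ⟨s, hs, rfl⟩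
    obtain ⟨m, rfl⟩ := (hp.vertex_iff s hs).1 hv
    exact ⟨m, Nat.cast_le.1 hs.2, rfl⟩
  · rintro ⟨m, hm, rfl⟩
    exact ⟨m, ⟨m.cast_nonneg, Nat.cast_le.2 hm⟩, rfl⟩

/-- The polygonal path through the points `z 0, …, z l` at integer times. -/
noncomputable def polygonalPath (z : ℕ → EuclideanSpace ℝ (Fin d)) (l : ℕ) (s : ℝ) :
    EuclideanSpace ℝ (Fin d) :=
  z 0 + ∑ e ∈ Finset.range l, max 0 (min 1 (s - e)) • (z (e + 1) - z e)

theorem polygonalPath_eq (z : ℕ → EuclideanSpace ℝ (Fin d)) {m : ℕ} (hm : m < l) {s : ℝ}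
    (hs : s ∈ Set.Icc (m : ℝ) (m + 1)) :
    polygonalPath z l s = z m + (s - m) • (z (m + 1) - z m) := by
  -- On `[m, m + 1]` the clamped weights are zero for `e > m` and one for `e < m`, and the latter
  -- terms telescope.
  have h1 : ∑ e ∈ Finset.range l, max 0 (min 1 (s - e)) • (z (e + 1) - z e)
      = ∑ e ∈ Finset.range (m + 1), max 0 (min 1 (s - e)) • (z (e + 1) - z e) := by
    refine (Finset.sum_subset (Finset.range_mono hm) fun e _ he => ?_).symm
    have : ((m + 1 : ℕ) : ℝ) ≤ e := Nat.cast_le.2 (by simpa using he)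
    push_cast at this
    rw [max_eq_left, zero_smul]
    exact (min_le_right _ _).trans (by linarith [hs.2])
  have h2 : ∑ e ∈ Finset.range m, max 0 (min 1 (s - e)) • (z (e + 1) - z e) = z m - z 0 := by
    rw [← Finset.sum_range_sub]
    refine Finset.sum_congr rfl fun e he => ?_
    have : ((e + 1 : ℕ) : ℝ) ≤ m := Nat.cast_le.2 (Finset.mem_range.1 he)
    push_cast at this
    rw [min_eq_left (by linarith [hs.1]), max_eq_right zero_le_one, one_smul]
  rw [polygonalPath, h1, Finset.sum_range_succ, h2, min_eq_right (by linarith [hs.2]),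
    max_eq_right (by linarith [hs.1])]
  abel

theorem polygonalPath_natCast (z : ℕ → EuclideanSpace ℝ (Fin d)) {m : ℕ} (hm : m ≤ l) :
    polygonalPath z l m = z m := by
  rcases hm.lt_or_eq with h | rfl
  · rw [polygonalPath_eq z h ⟨le_rfl, by linarith⟩]; simp
  · rcases m with _ | m
    · simp [polygonalPath]
    · rw [polygonalPath_eq z m.lt_succ_self ⟨by simp, by simp⟩]; simp

theorem isEdgeFollowingPath_polygonalPath {z : ℕ → EuclideanSpace ℝ (Fin d)}
    (hz : ∀ m ≤ l, z m ∈ P.extremePoints ℝ)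
    (he : ∀ m < l, IsPolytopeEdge P (segment ℝ (z m) (z (m + 1)))) :
    IsEdgeFollowingPath P l (polygonalPath z l) where
  continuousOn := by
    unfold polygonalPath
    fun_prop
  vertex_iff := by
    intro s hs
    constructor
    · intro hv
      by_contra! hne
      have h1 : (⌊s⌋₊ : ℝ) < s := lt_of_le_of_ne (Nat.floor_le hs.1) (hne _).symm
      have h2 : s < ⌊s⌋₊ + 1 := Nat.lt_floor_add_one s
      have hm : ⌊s⌋₊ < l := by exact_mod_cast h1.trans_le hs.2
      have hmem : polygonalPath z l s ∈ openSegment ℝ (z ⌊s⌋₊) (z (⌊s⌋₊ + 1)) := by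
        rw [polygonalPath_eq z hm ⟨h1.le, h2.le⟩]
        exact ⟨1 - (s - ⌊s⌋₊), s - ⌊s⌋₊, by linarith, by linarith, by ring, by module⟩
      have h3 := (mem_extremePoints.1 hv).2 _ (hz _ hm.le).1 _ (hz _ hm).1 hmem
      exact (he _ hm).ends.2.2 (h3.1.trans h3.2.symm)
    · rintro ⟨m, rfl⟩
      have hm : m ≤ l := Nat.cast_le.1 hs.2
      rw [polygonalPath_natCast z hm]
      exact hz m hm
  edge := by
    intro m hm
    have : polygonalPath z l '' Set.Icc (m : ℝ) (m + 1) = segment ℝ (z m) (z (m + 1)) := by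
      rw [segment_eq_image']
      ext y
      constructor
      · rintro ⟨s, hs, rfl⟩
        exact ⟨s - m, ⟨by linarith [hs.1], by linarith [hs.2]⟩, (polygonalPath_eq z hm hs).symm⟩
      · rintro ⟨θ, hθ, rfl⟩
        have hs : m + θ ∈ Set.Icc (m : ℝ) (m + 1) := ⟨by linarith [hθ.1], by linarith [hθ.2]⟩
        exact ⟨m + θ, hs, by rw [polygonalPath_eq z hm hs, add_sub_cancel_left]⟩
    rw [this]
    exact he m hm

/-- The edge graph of a polytope. -/
def edgeGraph (P : Set (EuclideanSpace ℝ (Fin d))) : SimpleGraph (EuclideanSpace ℝ (Fin d)) :=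
  SimpleGraph.fromRel fun a b => IsPolytopeEdge P (segment ℝ a b)

theorem edgeGraph_adj {a b : EuclideanSpace ℝ (Fin d)} :
    (edgeGraph P).Adj a b ↔ IsPolytopeEdge P (segment ℝ a b) := by
  rw [edgeGraph, SimpleGraph.fromRel_adj, segment_symm ℝ b a, or_self]
  exact ⟨fun h => h.2, fun h => ⟨h.ends.2.2, h⟩⟩

/-- `a` and `b` are joined by a walk of length at most `l` in the edge graph through points in `Q`. -/
def Connects (P Q : Set (EuclideanSpace ℝ (Fin d))) (l : ℕ) (a b : EuclideanSpace ℝ (Fin d)) :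
    Prop :=
  ∃ W : (edgeGraph P).Walk a b, W.length ≤ l ∧ ∀ z ∈ W.support, z ∈ Q

variable {Q : Set (EuclideanSpace ℝ (Fin d))} {a b c : EuclideanSpace ℝ (Fin d)} {m : ℕ}

theorem Connects.refl (ha : a ∈ Q) : Connects P Q l a a :=
  ⟨SimpleGraph.Walk.nil, Nat.zero_le _, by simpa using ha⟩

theorem Connects.symm (h : Connects P Q l a b) : Connects P Q l b a := by
  obtain ⟨W, hW, hQ⟩ := h
  exact ⟨W.reverse, by simpa using hW, by simpa using hQ⟩

theorem Connects.trans (h : Connects P Q l a b) (h' : Connects P Q m b c) :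
    Connects P Q (l + m) a c := by
  obtain ⟨W, hW, hQ⟩ := h
  obtain ⟨W', hW', hQ'⟩ := h'
  refine ⟨W.append W', by rw [SimpleGraph.Walk.length_append]; omega, fun z hz => ?_⟩
  rcases (SimpleGraph.Walk.mem_support_append_iff _ _).1 hz with h | h
  · exact hQ z h
  · exact hQ' z h

theorem Connects.mono (h : Connects P Q l a b) (hlm : l ≤ m) : Connects P Q m a b := by
  obtain ⟨W, hW, hQ⟩ := h
  exact ⟨W, hW.trans hlm, hQ⟩

theorem Connects.of_edge (h : IsPolytopeEdge P (segment ℝ a b)) (ha : a ∈ Q) (hb : b ∈ Q) :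
    Connects P Q 1 a b :=
  ⟨(edgeGraph_adj.2 h).toWalk, by simp, by simp [ha, hb]⟩

theorem Connects.exists_path (h : Connects P Q l a b) (hQ : Q ⊆ P.extremePoints ℝ) :
    ∃ m ≤ l, ∃ p : ℝ → EuclideanSpace ℝ (Fin d), IsEdgeFollowingPath P m p ∧
      p 0 = a ∧ p m = b ∧ ∀ e ≤ m, p (e : ℕ) ∈ Q := by
  obtain ⟨W, hW, hWQ⟩ := h
  have hmem : ∀ e, W.getVert e ∈ Q := fun e => hWQ _ (W.getVert_mem_support e)
  refine ⟨W.length, hW, polygonalPath W.getVert W.length,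
    isEdgeFollowingPath_polygonalPath (fun e _ => hQ (hmem e))
      (fun e he => edgeGraph_adj.1 (W.adj_getVert_succ he)), ?_, ?_, fun e he => ?_⟩
  · have := polygonalPath_natCast W.getVert (Nat.zero_le W.length)
    simpa using this
  · rw [polygonalPath_natCast W.getVert le_rfl, W.getVert_length]
  · rw [polygonalPath_natCast W.getVert he]
    exact hmem e

end EdgePaths

/-! ### Counterparts and the transfer of paths. -/

namespace IsFlip

open IsPassing

variable {d n : ℕ} {S : ℝ → HalfspaceSystem d n} {i k : Fin n} {t₀ : ℝ}
  {u x v w y z y' z' : EuclideanSpace ℝ (Fin d)}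

theorem isCounterpart_iff (hf : IsFlip S i t₀ u x k) (hvw : (v = u ∧ w = x) ∨ (v = x ∧ w = u)) :
    IsCounterpart S v w y y' ↔
      y ∈ (S 0).polytope.extremePoints ℝ ∧ y' ∈ (S 1).polytope.extremePoints ℝ ∧
        ((y ≠ u ∧ y ≠ x ∧ (S 1).tight y' = (S 0).tight y) ∨
          ((y = u ∨ y = x) ∧ y' ∈ (S 1).facet i ∩ (S 1).facet k)) := by
  rw [IsCounterpart, hf.newFace_eq hvw]
  refine and_congr_right fun hy => and_congr_right fun hy' => ?_
  have h : (∀ j, y ∈ (S 0).facet j ↔ y' ∈ (S 1).facet j) ↔ (S 1).tight y' = (S 0).tight y := by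
    rw [Finset.ext_iff]
    refine forall_congr' fun j => ?_
    rw [mem_facet_iff hy.1, mem_facet_iff hy'.1]
    exact Iff.comm
  rw [h]
  rcases hvw with ⟨rfl, rfl⟩ | ⟨rfl, rfl⟩ <;> tauto

theorem exists_isCounterpart (hf : IsFlip S i t₀ u x k)
    (hvw : (v = u ∧ w = x) ∨ (v = x ∧ w = u)) (hd : 2 ≤ d)
    (hy : y ∈ (S 0).polytope.extremePoints ℝ) : ∃ y', IsCounterpart S v w y y' := by
  simp only [hf.isCounterpart_iff hvw]
  by_cases h : y = u ∨ y = x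
  · obtain ⟨q, hq⟩ := hf.exists_newVertex
    have hcard := hf.card_erase hf.mem_tight
    obtain ⟨m, hm⟩ := Finset.card_pos.1 (show 0 < (((S 0).tight u).erase k).card by omega)
    exact ⟨q m, hy, (hq m hm).1, Or.inr ⟨h, hf.newVertex_mem hm (hq m hm)⟩⟩
  · push Not at h
    obtain ⟨y', hy', hyy⟩ := hf.isVertexIndex_one hy h.1 h.2
    exact ⟨y', hy, hy', Or.inl ⟨h.1, h.2, hyy⟩⟩

theorem isPolytopeEdge_of_tight_eq (hf : IsFlip S i t₀ u x k)
    (hy' : y' ∈ (S 1).polytope.extremePoints ℝ) (hz' : z' ∈ (S 1).polytope.extremePoints ℝ)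
    (hyy : (S 1).tight y' = (S 0).tight y) (hzz : (S 1).tight z' = (S 0).tight z)
    (h : IsPolytopeEdge (S 0).polytope (segment ℝ y z)) :
    IsPolytopeEdge (S 1).polytope (segment ℝ y' z') := by
  obtain ⟨hy, hz, hyz⟩ := h.ends
  have hne : y' ≠ z' := by
    rintro rfl
    exact hyz (eq_of_tight_subset hy (hyy.symm.trans hzz).le)
  rw [isPolytopeEdge_segment_iff hf.isSimple_one hy' hz' hne, hyy, hzz]
  exact (isPolytopeEdge_segment_iff hf.isSimple_zero hy hz hyz).1 h

/-- A neighbor of an end of the vanishing edge shares `d - 1` facets with a vertex of the new face. -/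
theorem exists_adjacent_newVertex (hf : IsFlip S i t₀ u x k)
    (hy' : y' ∈ (S 1).polytope.extremePoints ℝ) (hyu : y ≠ u) (hyx : y ≠ x)
    (hyy : (S 1).tight y' = (S 0).tight y) (hz : z = u ∨ z = x)
    (h : IsPolytopeEdge (S 0).polytope (segment ℝ y z)) :
    ∃ z' ∈ (S 1).polytope.extremePoints ℝ, z' ∈ (S 1).facet i ∩ (S 1).facet k ∧
      IsPolytopeEdge (S 1).polytope (segment ℝ y' z') := by
  obtain ⟨hy, hz0, hyz⟩ := h.ends
  have hcard := (isPolytopeEdge_segment_iff hf.isSimple_zero hy hz0 hyz).1 h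
  have hzc := isSimple_iff.1 hf.isSimple_zero z hz0
  have hux : u ≠ x := (hf.ne_of_tight_eq_neighbor hf.tight_other).symm
  obtain ⟨c, hcz, hcy⟩ : ∃ c ∈ (S 0).tight z, c ∉ (S 0).tight y := by
    by_contra! hsub
    exact hyz (eq_of_tight_subset hz0 hsub).symm
  have herase : ((S 0).tight z).erase c ⊆ (S 0).tight y := by
    have h1 : (S 0).tight y ∩ (S 0).tight z ⊆ ((S 0).tight z).erase c := fun m hm => by
      rw [Finset.mem_inter] at hm
      exact Finset.mem_erase.2 ⟨ne_of_mem_of_not_mem hm.1 hcy, hm.2⟩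
    have h2 : (((S 0).tight z).erase c).card + 1 = d := by
      rw [Finset.card_erase_add_one hcz, hzc]
    rw [← Finset.eq_of_subset_of_card_le h1 (by omega)]
    exact Finset.inter_subset_left
  -- The face on `D` without `k` is the vanishing edge, whose only vertices are `u` and `x`. So the
  -- facet `c` left on the way from `z` to `y` is one containing the whole vanishing edge, and the
  -- new vertex omitting `c` is the right neighbor.
  have hnot : ¬ ((S 0).tight u).erase k ⊆ (S 0).tight y := by
    intro hsub
    have hmem : y ∈ (S 0).face (((S 0).tight u).erase k) := ⟨hy.1, hsub⟩
    rw [face_eq_segment hf.isSimple_zero hf.mem_extremePoints hf.mem_extremePoints_other hux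
      (Finset.erase_subset _ _) (hf.tight_other ▸ erase_subset_neighbor k)
      (hf.card_erase hf.mem_tight).ge] at hmem
    rcases eq_or_eq_of_mem_segment hy hf.mem_extremePoints.1 hf.mem_extremePoints_other.1 hmem
      with h | h
    · exact hyu h
    · exact hyx h
  have hc : c ∈ ((S 0).tight u).erase k ∧
      ((S 0).tight z).erase c ⊆ neighbor S i u c := by
    rcases hz with rfl | rfl
    · refine ⟨Finset.mem_erase.2 ⟨?_, hcz⟩, erase_subset_neighbor c⟩
      rintro rfl
      exact hnot herase
    · rw [hf.tight_other] at hcz herase ⊢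
      have hck : c ∈ ((S 0).tight u).erase k := by
        refine (Finset.mem_insert.1 hcz).resolve_left ?_
        rintro rfl
        refine hnot fun m hm => herase (Finset.mem_erase.2 ⟨?_, erase_subset_neighbor k hm⟩)
        rintro rfl
        exact hf.notMem_tight (Finset.mem_of_mem_erase hm)
      refine ⟨hck, fun m hm => ?_⟩
      obtain ⟨hmc, hm⟩ := Finset.mem_erase.1 hm
      rcases Finset.mem_insert.1 hm with rfl | hm
      · exact Finset.mem_insert_self _ _
      · exact erase_subset_neighbor c (Finset.mem_erase.2 ⟨hmc, Finset.mem_of_mem_erase hm⟩)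
  obtain ⟨q, hq⟩ := hf.exists_newVertex
  obtain ⟨hq1, hq2⟩ := hq c hc.1
  have hcu := Finset.mem_of_mem_erase hc.1
  -- Otherwise `neighbor S i u c` would be an index set in `P(0)`, which forces `c = k`.
  have hne : y' ≠ q c := by
    intro h'
    refine Finset.ne_of_mem_erase hc.1 ((hf.isVertexIndex_zero_iff c hcu).1 ⟨y, hy, ?_⟩)
    rw [← hyy, h', hq2]
  refine ⟨q c, hq1, hf.newVertex_mem hc.1 (hq c hc.1), ?_⟩
  rw [isPolytopeEdge_segment_iff hf.isSimple_one hy' hq1 hne, hyy, hq2]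
  have h1 := Finset.card_le_card (Finset.subset_inter herase hc.2)
  have h2 := Finset.card_erase_add_one hcz
  omega

theorem exists_adjacent_counterpart (hf : IsFlip S i t₀ u x k)
    (hvw : (v = u ∧ w = x) ∨ (v = x ∧ w = u)) (hyu : y ≠ u) (hyx : y ≠ x)
    (hy' : IsCounterpart S v w y y') (h : IsPolytopeEdge (S 0).polytope (segment ℝ y z)) :
    ∃ z', IsCounterpart S v w z z' ∧ IsPolytopeEdge (S 1).polytope (segment ℝ y' z') := by
  simp only [hf.isCounterpart_iff hvw] at hy' ⊢
  obtain ⟨-, hy1, ⟨-, -, hyy⟩ | ⟨h', -⟩⟩ := hy'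
  · have hz := h.ends.2.1
    by_cases hzz : z = u ∨ z = x
    · obtain ⟨z', hz', hzN, he⟩ := hf.exists_adjacent_newVertex hy1 hyu hyx hyy hzz h
      exact ⟨z', ⟨hz, hz', Or.inr ⟨hzz, hzN⟩⟩, he⟩
    · push Not at hzz
      obtain ⟨z', hz', hzt⟩ := hf.isVertexIndex_one hz hzz.1 hzz.2
      exact ⟨z', ⟨hz, hz', Or.inl ⟨hzz.1, hzz.2, hzt⟩⟩,
        hf.isPolytopeEdge_of_tight_eq hy1 hz' hyy hzt h⟩
  · tauto

/-- A walk that reaches the vanishing edge has a counterpart that reaches the new face. -/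
theorem exists_connects_newFace (hf : IsFlip S i t₀ u x k)
    (hvw : (v = u ∧ w = x) ∨ (v = x ∧ w = u)) {Q : Set (EuclideanSpace ℝ (Fin d))} (l : ℕ) :
    ∀ (f : ℕ → EuclideanSpace ℝ (Fin d)) (y' : EuclideanSpace ℝ (Fin d)),
      (∀ m ≤ l, ∀ z, IsCounterpart S v w (f m) z → z ∈ Q) →
      (∀ m < l, IsPolytopeEdge (S 0).polytope (segment ℝ (f m) (f (m + 1)))) →
      (∀ m < l, ¬ (f m = u ∨ f m = x)) → (f l = u ∨ f l = x) →
      IsCounterpart S v w (f 0) y' →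
      ∃ z, IsCounterpart S v w (f l) z ∧ Connects (S 1).polytope Q l y' z := by
  induction l with
  | zero =>
    intro f y' hQ _ _ _ hy'
    exact ⟨y', hy', Connects.refl (hQ 0 le_rfl y' hy')⟩
  | succ l ih =>
    intro f y' hQ hedge hoff hl hy'
    have h0 := hoff 0 l.succ_pos
    push Not at h0
    obtain ⟨z', hz', he⟩ := hf.exists_adjacent_counterpart hvw h0.1 h0.2 hy' (hedge 0 l.succ_pos)
    obtain ⟨z, hz, hc⟩ := ih (fun m => f (m + 1)) z' (fun m hm => hQ (m + 1) (by omega))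
      (fun m hm => hedge (m + 1) (by omega)) (fun m hm => hoff (m + 1) (by omega)) hl hz'
    refine ⟨z, hz, ?_⟩
    rw [add_comm l 1]
    exact (Connects.of_edge he (hQ 0 (by omega) _ hy') (hQ 1 (by omega) _ hz')).trans hc

/-- A walk through both ends of the vanishing edge has a counterpart that is not longer. -/
theorem connects_of_passesThrough (hf : IsFlip S i t₀ u x k)
    (hvw : (v = u ∧ w = x) ∨ (v = x ∧ w = u)) {Q : Set (EuclideanSpace ℝ (Fin d))} {l : ℕ}
    {f : ℕ → EuclideanSpace ℝ (Fin d)}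
    (hQ : ∀ m ≤ l, ∀ z, IsCounterpart S v w (f m) z → z ∈ Q)
    (hedge : ∀ m < l, IsPolytopeEdge (S 0).polytope (segment ℝ (f m) (f (m + 1))))
    (hu : ∃ m ≤ l, f m = u) (hx : ∃ m ≤ l, f m = x)
    (hy' : IsCounterpart S v w (f 0) y') (hz' : IsCounterpart S v w (f l) z') :
    Connects (S 1).polytope Q l y' z' := by
  classical
  obtain ⟨a, hal, ha⟩ := hu
  obtain ⟨b, hbl, hb⟩ := hx
  have hab : a ≠ b := by
    rintro rfl
    exact (hf.ne_of_tight_eq_neighbor hf.tight_other) (hb.symm.trans ha)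
  have hA : ∃ m, f m = u ∨ f m = x := ⟨a, Or.inl ha⟩
  -- Counted backwards from the end, so that `l - β` is the last visit to the vanishing edge.
  have hB : ∃ m, f (l - m) = u ∨ f (l - m) = x := ⟨l - a, Or.inl (by rw [Nat.sub_sub_self hal, ha])⟩
  set α := Nat.find hA
  set β := Nat.find hB
  have hαa : α ≤ a := Nat.find_min' hA (Or.inl ha)
  have hαb : α ≤ b := Nat.find_min' hA (Or.inr hb)
  have hβa : β ≤ l - a := Nat.find_min' hB (Or.inl (by rw [Nat.sub_sub_self hal, ha]))
  have hβb : β ≤ l - b := Nat.find_min' hB (Or.inr (by rw [Nat.sub_sub_self hbl, hb]))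
  obtain ⟨p, hp, hcp⟩ := hf.exists_connects_newFace hvw α f y' (fun m hm => hQ m (by omega))
    (fun m hm => hedge m (by omega)) (fun m hm => Nat.find_min hA hm) (Nat.find_spec hA) hy'
  obtain ⟨q, hq, hcq⟩ := hf.exists_connects_newFace hvw β (fun m => f (l - m)) z'
    (fun m hm => hQ (l - m) (by omega)) (fun m hm => by
      have := hedge (l - (m + 1)) (by omega)
      rwa [show l - (m + 1) + 1 = l - m by omega, segment_symm] at this)
    (fun m hm => Nat.find_min hB hm) (Nat.find_spec hB) hz'
  have hpQ := hQ α (by omega) p hp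
  have hqQ := hQ (l - β) (by omega) q hq
  rw [hf.isCounterpart_iff hvw] at hp hq
  have hpN : p ∈ (S 1).facet i ∩ (S 1).facet k := by
    have := Nat.find_spec hA
    tauto
  have hqN : q ∈ (S 1).facet i ∩ (S 1).facet k := by
    have := Nat.find_spec hB
    tauto
  -- The extra edge is paid for: `a ≠ b` both lie between `α` and `l - β`, so `α + 1 + β ≤ l`.
  have hpq : Connects (S 1).polytope Q 1 p q := by
    by_cases hpq : p = q
    · exact hpq ▸ Connects.refl hpQ
    · exact Connects.of_edge (hf.isPolytopeEdge_of_mem_newFace hp.2.1 hq.2.1 hpN hqN hpq) hpQ hqQ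
  exact ((hcp.trans hpq).trans hcq.symm).mono (by omega)

end IsFlip

theorem mainTheorem2 {d n : ℕ} (hd : 3 ≤ d) (S : ℝ → HalfspaceSystem d n) (i : Fin n)
    (hS : IsFundamentalDeformation S i) (v w : EuclideanSpace ℝ (Fin d))
    (hvw : IsVanishingEdge S (segment ℝ v w)) :
    (∃ k, k ≠ i ∧
      (∀ j, Xor (v ∈ (S 0).facet j) (w ∈ (S 0).facet j) ↔ j = i ∨ j = k) ∧
      newFace S v w = (S 1).facet i ∩ (S 1).facet k) ∧
    (∃ q : Fin (d - 1) → EuclideanSpace ℝ (Fin d), AffineIndependent ℝ q ∧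
      newFace S v w = convexHull ℝ (Set.range q)) ∧
    (∀ x ∈ (S 1).polytope.extremePoints ℝ, ∀ y ∈ (S 1).polytope.extremePoints ℝ,
      x ∈ newFace S v w → y ∈ newFace S v w → x ≠ y →
        IsPolytopeEdge (S 1).polytope (segment ℝ x y)) ∧
    (∀ x ∈ (S 0).polytope.extremePoints ℝ, ∃ x', IsCounterpart S v w x x') ∧
    ∀ (l : ℕ) (p : ℝ → EuclideanSpace ℝ (Fin d)),
      IsEdgeFollowingPath (S 0).polytope l p → p 0 ≠ p l →
      ¬ Xor (PassesThrough l p v) (PassesThrough l p w) →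
      ∀ x' y', IsCounterpart S v w (p 0) x' → IsCounterpart S v w (p l) y' →
        ∃ l' ≤ l, ∃ p' : ℝ → EuclideanSpace ℝ (Fin d),
          IsEdgeFollowingPath (S 1).polytope l' p' ∧ p' 0 = x' ∧ p' l' = y' ∧
          (∀ m' : ℕ, m' ≤ l' → ∃ m : ℕ, m ≤ l ∧ IsCounterpart S v w (p m) (p' m')) ∧
          (¬ PassesThrough l p v → ¬ PassesThrough l p w →
            l' = l ∧ ∀ m : ℕ, m ≤ l → IsCounterpart S v w (p m) (p' m)) := by
  obtain ⟨t₀, u, hp⟩ := hS.exists_isPassing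
  obtain ⟨x, k, hf, hvwux⟩ := hp.exists_isFlip hvw
  have hface := hf.newFace_eq hvwux
  have hv := hvw.1.ends.1
  have hw := hvw.1.ends.2.1
  refine ⟨⟨k, hf.ne, fun j => ?_, hface⟩, ?_, ?_,
    fun y hy => hf.exists_isCounterpart hvwux (by omega) hy, ?_⟩
  · rcases hvwux with ⟨rfl, rfl⟩ | ⟨rfl, rfl⟩
    · exact hf.xor_iff j
    · rw [xor_comm]; exact hf.xor_iff j
  · rw [hface]; exact hf.exists_simplex
  · rw [hface]
    exact fun y hy z hz hyN hzN hyz => hf.isPolytopeEdge_of_mem_newFace hy hz hyN hzN hyz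
  intro l p hpath _ hxor x' y' hx' hy'
  have hedge : ∀ m < l, IsPolytopeEdge (S 0).polytope (segment ℝ (p m) (p (m + 1 : ℕ))) :=
    fun m hm => hpath.isPolytopeEdge hm
  by_cases hpv : PassesThrough l p v
  · have hpw : PassesThrough l p w := by
      by_contra h
      exact hxor (Or.inl ⟨hpv, h⟩)
    have hpv' := (hpath.passesThrough_iff hv).1 hpv
    have hpw' := (hpath.passesThrough_iff hw).1 hpw
    have hc : Connects (S 1).polytope {z | ∃ m ≤ l, IsCounterpart S v w (p (m : ℕ)) z} l x' y' :=
      hf.connects_of_passesThrough hvwux (f := fun m => p m)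
        (fun m hm z hz => ⟨m, hm, hz⟩) hedge
        (by rcases hvwux with ⟨rfl, rfl⟩ | ⟨rfl, rfl⟩ <;> assumption)
        (by rcases hvwux with ⟨rfl, rfl⟩ | ⟨rfl, rfl⟩ <;> assumption)
        (by simpa using hx') hy'
    obtain ⟨l', hl', p', hp', h0, h1, hQ⟩ := hc.exists_path fun z ⟨_, _, hz⟩ => hz.2.1
    exact ⟨l', hl', p', hp', h0, h1, hQ, fun h => absurd hpv h⟩
  · have hpw : ¬ PassesThrough l p w := fun h => hxor (Or.inr ⟨h, hpv⟩)
    have hoff : ∀ m ≤ l, p (m : ℕ) ≠ v ∧ p (m : ℕ) ≠ w := fun m hm =>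
      ⟨fun h => hpv ((hpath.passesThrough_iff hv).2 ⟨m, hm, h⟩),
        fun h => hpw ((hpath.passesThrough_iff hw).2 ⟨m, hm, h⟩)⟩
    have hex : ∀ m, ∃ z, m ≤ l → IsCounterpart S v w (p (m : ℕ)) z := by
      intro m
      by_cases hm : m ≤ l
      · obtain ⟨z, hz⟩ := hf.exists_isCounterpart hvwux (by omega) (hpath.mem_extremePoints hm)
        exact ⟨z, fun _ => hz⟩
      · exact ⟨0, fun h => absurd h hm⟩
    choose z hz using hex
    have htight : ∀ m ≤ l, ∀ y, IsCounterpart S v w (p (m : ℕ)) y →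
        y ∈ (S 1).polytope.extremePoints ℝ ∧ (S 1).tight y = (S 0).tight (p (m : ℕ)) := by
      intro m hm y hy
      have hne : p (m : ℕ) ≠ u ∧ p (m : ℕ) ≠ x := by
        have := hoff m hm
        rcases hvwux with ⟨rfl, rfl⟩ | ⟨rfl, rfl⟩
        · exact this
        · exact this.symm
      rw [hf.isCounterpart_iff hvwux] at hy
      tauto
    -- Off the vanishing edge counterparts are unique, so the transferred path has the prescribed
    -- ends.
    have huniq : ∀ m ≤ l, ∀ y, IsCounterpart S v w (p (m : ℕ)) y → z m = y := fun m hm y hy =>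
      eq_of_tight_subset (htight m hm _ (hz m hm)).1
        ((htight m hm _ (hz m hm)).2.trans (htight m hm y hy).2.symm).le
    have hpz := isEdgeFollowingPath_polygonalPath (P := (S 1).polytope) (l := l) (z := z)
      (fun m hm => (htight m hm _ (hz m hm)).1)
      (fun m hm => hf.isPolytopeEdge_of_tight_eq (htight m hm.le _ (hz m hm.le)).1
        (htight (m + 1) hm _ (hz (m + 1) hm)).1 (htight m hm.le _ (hz m hm.le)).2
        (htight (m + 1) hm _ (hz (m + 1) hm)).2 (hedge m hm))
    have hval : ∀ m ≤ l, IsCounterpart S v w (p (m : ℕ)) (polygonalPath z l m) := fun m hm => by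
      rw [polygonalPath_natCast z hm]
      exact hz m hm
    refine ⟨l, le_rfl, polygonalPath z l, hpz, ?_, ?_, fun m hm => ⟨m, hm, hval m hm⟩,
      fun _ _ => ⟨rfl, hval⟩⟩
    · have := polygonalPath_natCast z (Nat.zero_le l)
      rw [Nat.cast_zero] at this
      rw [this]
      exact huniq 0 (Nat.zero_le l) x' (by simpa using hx')
    · rw [polygonalPath_natCast z le_rfl]
      exact huniq l le_rfl y' hy'
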